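/- Let $G$ be a nontrivial finite soluble group. For $x,y\in G$ write $x\equiv_{\mathrm m}y$ if $x$ and $y$ lie in exactly the same maximal subgroups of $G$, and for each integer $r\ge 1$ write $x\equiv_{\mathrm m}^{(r)}y$ if for all $z_1,\dots,z_{r-1}\in G$ we have $\langle x,z_1,\dots,z_{r-1}\rangle=G$ if and only if $\langle y,z_1,\dots,z_{r-1}\rangle=G$. Let $\psi(G)$ be the least integer $r\ge 1$ for which the relations $\equiv_{\mathrm m}^{(r)}$ and $\equiv_{\mathrm m}$ coincide, let $d(X)$ denote the minimum number of generators of a finite group $X$, and let $\mathrm{Frat}(G)$ be the Frattini subgroup of $G$. Then $\psi(G)=d(G)$ if and only if one of the following holds: (i) $G$ is a finite $p$-group for some prime $p$; or (ii) there exist a prime $p$, a finite vector space $V$ over the prime field $\mathbb F_p$, a nontrivial soluble subgroup $H$ of $\mathrm{Aut}(V)=\mathrm{GL}_{\mathbb F_p}(V)$ acting irreducibly on $V$, and an integer $d>d(H)$, such that $$G/\mathrm{Frat}(G)\;\cong\; V^{\,r(d-2)+1}:H ,$$ where $r=\dim_{\mathrm{End}_H(V)}V$, $\mathrm{End}_H(V)$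 is the field of $\mathbb F_p$-linear endomorphisms of $V$ that commute with $H$, and the right-hand side is the semidirect product in which $H$ acts in the same way, by its natural action, on each of the $r(d-2)+1$ factors $V$. -/

import Mathlib

namespace GenEquiv

/-- `x ≡ₘ y`: the elements `x` and `y` lie in exactly the same maximal subgroups of `G`. -/
def EquivM {G : Type*} [Group G] (x y : G) : Prop :=
  ∀ M : Subgroup G, IsCoatom M → (x ∈ M ↔ y ∈ M)

/-- `x ≡ₘ^(r) y` (for `r ≥ 1`): for all `z₁, …, z_{r-1}` in `G`, the elements
`x, z₁, …, z_{r-1}` generate `G` if and only if `y, z₁, …, z_{r-1}` do. -/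
def EquivMr {G : Type*} [Group G] (r : ℕ) (x y : G) : Prop :=
  ∀ z : Fin (r - 1) → G,
    Subgroup.closure (insert x (Set.range z)) = ⊤ ↔
      Subgroup.closure (insert y (Set.range z)) = ⊤

/-- `ψ(G)`: the least positive integer `r` such that `≡ₘ^(r)` coincides with `≡ₘ`. -/
noncomputable def psi (G : Type*) [Group G] : ℕ :=
  sInf {r : ℕ | 1 ≤ r ∧ ∀ x y : G, EquivMr r x y ↔ EquivM x y}

/-- The set over which the infimum in `psi` is taken is nonempty for a finite group, so that
`psi G` is attained. -/
theorem psi_spec (G : Type*) [Group G] [Finite G] :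
    1 ≤ psi G ∧ ∀ x y : G, EquivMr (psi G) x y ↔ EquivM x y := by
  refine Nat.sInf_mem (s := {r : ℕ | 1 ≤ r ∧ ∀ x y : G, EquivMr r x y ↔ EquivM x y})
    ⟨Nat.card G + 1, by omega, fun x y => ⟨?_, ?_⟩⟩
  · have key : ∀ x y : G, EquivMr (Nat.card G + 1) x y →
        ∀ M : Subgroup G, IsCoatom M → y ∈ M → x ∈ M := by
      intro x y h M hM hy
      by_contra hx
      let e : Fin (Nat.card G) ≃ G := (Finite.equivFin G).symm
      classical
      let z : Fin (Nat.card G + 1 - 1) → G := fun i => if e i ∈ M then e i else 1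
      have hz : Set.range z = (M : Set G) := by
        ext g
        constructor
        · rintro ⟨i, rfl⟩
          by_cases hi : e i ∈ M
          · simp only [z, if_pos hi]
            exact hi
          · simp only [z, if_neg hi]
            exact M.one_mem
        · intro hg
          refine ⟨e.symm g, ?_⟩
          have hg' : e (e.symm g) ∈ M := by simpa using hg
          simp [z, SetLike.mem_coe.1 hg]
      have h1 : Subgroup.closure (insert x (Set.range z)) = ⊤ := by
        rw [hz]
        refine hM.2 _ (lt_of_le_of_ne ?_ ?_)
        · intro g hg
          exact Subgroup.subset_closure (Set.mem_insert_of_mem _ hg)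
        · intro he
          apply hx
          rw [he]
          exact Subgroup.subset_closure (Set.mem_insert _ _)
      have h2 := (h z).1 h1
      rw [hz, Set.insert_eq_of_mem (show y ∈ (M : Set G) from hy), Subgroup.closure_eq] at h2
      exact hM.1 h2
    intro h M hM
    exact ⟨key y x (fun z => (h z).symm) M hM, key x y h M hM⟩
  · have key : ∀ x y : G, EquivM x y → ∀ s : Set G,
        Subgroup.closure (insert x s) = ⊤ → Subgroup.closure (insert y s) = ⊤ := by
      intro x y h s hx
      by_contra hy
      obtain ⟨M, hM, hle⟩ := (eq_top_or_exists_le_coatom _).resolve_left hy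
      have hyM : y ∈ M := hle (Subgroup.subset_closure (Set.mem_insert _ _))
      have hs : insert x s ⊆ (M : Set G) := by
        intro g hg
        rcases hg with rfl | hg
        · exact (h M hM).2 hyM
        · exact hle (Subgroup.subset_closure (Set.mem_insert_of_mem _ hg))
      exact hM.1 (top_le_iff.1 (hx ▸ (Subgroup.closure_le M).2 hs))
    intro h z
    exact ⟨key x y h _, key y x (fun M hM => (h M hM).symm) _⟩

instance finite_linearEquiv (k V : Type*) [Semiring k] [AddCommMonoid V] [Module k V] [Finite V] :
    Finite (V ≃ₗ[k] V) :=
  DFunLike.finite _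

/-- The natural representation on `V` of a subgroup `H` of the general linear group of `V`. -/
def natRep {k V : Type*} [Field k] [AddCommGroup V] [Module k V]
    (H : Subgroup (V ≃ₗ[k] V)) : Representation k H V where
  toFun h := ((h : V ≃ₗ[k] V) : V →ₗ[k] V)
  map_one' := rfl
  map_mul' _ _ := rfl

/-- `End_H(V)`: the algebra of those linear endomorphisms of `V` that commute with `H`. It acts on
`V` by evaluation. -/
abbrev endH {k V : Type*} [Field k] [AddCommGroup V] [Module k V]
    (H : Subgroup (V ≃ₗ[k] V)) : Subalgebra k (Module.End k V) :=
  Subalgebra.centralizer k (Set.range (natRep H))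

/-- The diagonal action of `H` on the (multiplicatively written) group `V^n`. -/
def diagAction {k V : Type*} [Field k] [AddCommGroup V] [Module k V]
    (H : Subgroup (V ≃ₗ[k] V)) (n : ℕ) : H →* MulAut (Multiplicative (Fin n → V)) where
  toFun h := AddEquiv.toMultiplicative
    (AddEquiv.piCongrRight fun _ : Fin n => (h : V ≃ₗ[k] V).toAddEquiv)
  map_one' := rfl
  map_mul' _ _ := rfl

/-- The semidirect product `V^n : H`, with `H` acting in the same way on each factor `V`. -/
abbrev PowSemidirect {k V : Type*} [Field k] [AddCommGroup V] [Module k V]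
    (H : Subgroup (V ≃ₗ[k] V)) (n : ℕ) : Type _ :=
  SemidirectProduct (Multiplicative (Fin n → V)) H (diagAction H n)

end GenEquiv

namespace GenEquiv

/-! ### Generating tuples, the rank and `psi` -/

/-! Fewer than `d(G)` elements never generate, so `≡ₘ^(r)` relates all elements when `r < d(G)`,
while `≡ₘ` does not, since `Frat(G) ≠ G`. Hence `d(G) ≤ ψ(G)` always. If equality holds, comparing
elements with `1` shows that every nontrivial element of `X = G/Frat(G)` lies in a generating tuple
of length `m + 1 = d(G)`.

Let `A` be a minimal normal subgroup of `X`, viewed as an irreducible module `V` for the group `H`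
that `X` induces on it, with `K = End_H(V)` and `r = dim_K V`. Complete some `a ≠ 1` in `A` to
generators `a, z₁, …, z_m`. Each tuple `zᵢaᵢ` with `aᵢ ∈ A` generates a complement of `A`, and
complements yield crossed homomorphisms `X → V`; these therefore span more than `rm` dimensions
(`lt_finrank_cocycles`). Conversely, crossed homomorphisms are determined on generators, so a space
of them of dimension above `rm` has `1` as its only common zero (`eq_one_of_forall_eq_zero`). If `H
= 1`, this gives `X` exponent `p`. Otherwise `H¹(H, V) = 0` leaves `r(m-1)+1` crossed homomorphisms
independent on the kernel of the action, and they are the coordinates of an isomorphism `X ≅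
V^(r(m-1)+1) : H` (`exists_isPowerExtension`).

For the converse it suffices, modulo `Frat(G)`, to find for every maximal `M` and `x ∉ M` a tuple in
`M`, one shorter than the claimed value of `ψ`, that generates together with `x`
(`equivM_of_equivMr`). For `p`-groups this is linear algebra. In `V^n : H`, a proper subgroup
mapping onto `H` satisfies a linear relation among the coordinates modulo principal crossed
homomorphisms. The value of `n` is just small enough to lift a tuple acting without common fixed
points so that only one prescribed relation survives, up to scalars (`exists_lift`); it is chosen to
fail at `x`. When `M` contains `V^n`, the tuple in `H` comes from
`exists_tuple_mem_closure_insert_eq_top`. -/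

theorem rank_le_iff_exists_tuple {G : Type*} [Group G] [Finite G] {m : ℕ} :
    Group.rank G ≤ m ↔ ∃ z : Fin m → G, Subgroup.closure (Set.range z) = ⊤ := by
  classical
  constructor
  · intro h
    obtain ⟨S, hS, hc⟩ := Group.rank_spec G
    refine ⟨fun i => if hi : (i : ℕ) < S.card then (S.equivFin.symm ⟨i, hi⟩ : G) else 1, ?_⟩
    rw [eq_top_iff, ← hc, Subgroup.closure_le]
    intro s hs
    refine Subgroup.subset_closure ⟨⟨S.equivFin ⟨s, hs⟩, ?_⟩, ?_⟩
    · exact (S.equivFin ⟨s, hs⟩).2.trans_le (hS.trans_le h)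
    · simp
  · rintro ⟨z, hz⟩
    have h : Subgroup.closure ((Finset.univ.image z : Finset G) : Set G) = ⊤ := by
      simpa using hz
    exact (Group.rank_le h).trans (Finset.card_image_le.trans (by simp))

theorem equivMr_of_equivM {G : Type*} [Group G] [Finite G] {x y : G} (h : EquivM x y) (r : ℕ) :
    EquivMr r x y := by
  have key : ∀ x y : G, EquivM x y → ∀ s : Set G,
      Subgroup.closure (insert x s) = ⊤ → Subgroup.closure (insert y s) = ⊤ := by
    intro x y h s hx
    by_contra hy
    obtain ⟨M, hM, hle⟩ := (eq_top_or_exists_le_coatom _).resolve_left hy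
    have hyM : y ∈ M := hle (Subgroup.subset_closure (Set.mem_insert _ _))
    have hs : insert x s ⊆ (M : Set G) := by
      intro g hg
      rcases hg with rfl | hg
      · exact (h M hM).2 hyM
      · exact hle (Subgroup.subset_closure (Set.mem_insert_of_mem _ hg))
    exact hM.1 (top_le_iff.1 (hx ▸ (Subgroup.closure_le M).2 hs))
  exact fun z => ⟨key x y h _, key y x (fun M hM => (h M hM).symm) _⟩

theorem psi_le {G : Type*} [Group G] [Finite G] {r : ℕ} (hr : 1 ≤ r)
    (h : ∀ x y : G, EquivMr r x y → EquivM x y) : psi G ≤ r :=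
  Nat.sInf_le ⟨hr, fun x y => ⟨h x y, fun h => equivMr_of_equivM h r⟩⟩

theorem closure_insert_range {G : Type*} [Group G] {m : ℕ} (x : G) (z : Fin m → G) :
    Subgroup.closure (insert x (Set.range z)) =
      Subgroup.closure (Set.range (Fin.cons x z : Fin (m + 1) → G)) := by
  rw [Fin.range_cons]

theorem equivMr_of_lt_rank {G : Type*} [Group G] [Finite G] {r : ℕ} (hr : 1 ≤ r)
    (h : r < Group.rank G) (x y : G) : EquivMr r x y := by
  have key : ∀ (x : G) (z : Fin (r - 1) → G), Subgroup.closure (insert x (Set.range z)) ≠ ⊤ := by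
    intro x z hz
    rw [closure_insert_range] at hz
    have := rank_le_iff_exists_tuple.2 ⟨_, hz⟩
    omega
  exact fun z => ⟨fun hz => (key x z hz).elim, fun hz => (key y z hz).elim⟩

theorem mem_frattini_iff {G : Type*} [Group G] {x : G} :
    x ∈ frattini G ↔ ∀ M : Subgroup G, IsCoatom M → x ∈ M := by
  simp [frattini, Order.radical, Subgroup.mem_iInf]

theorem equivM_one_iff {G : Type*} [Group G] {x : G} : EquivM x 1 ↔ x ∈ frattini G := by
  simp [EquivM, mem_frattini_iff, one_mem]

theorem frattini_ne_top {G : Type*} [Group G] [Finite G] [Nontrivial G] : frattini G ≠ ⊤ := by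
  obtain ⟨M, hM, -⟩ := (eq_top_or_exists_le_coatom (⊥ : Subgroup G)).resolve_left bot_ne_top
  exact fun h => hM.1 (top_le_iff.1 (h ▸ frattini_le_coatom hM))

theorem rank_le_psi {G : Type*} [Group G] [Finite G] [Nontrivial G] : Group.rank G ≤ psi G := by
  obtain ⟨h1, h2⟩ := psi_spec G
  by_contra hlt
  push Not at hlt
  refine frattini_ne_top (G := G) (eq_top_iff.2 fun x _ => ?_)
  exact equivM_one_iff.1 ((h2 x 1).1 (equivMr_of_lt_rank h1 hlt x 1))

/-- If no such tuple existed, `x` and `1` would be `≡ₘ^(d)`-equivalent, because `1` adds nothing to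
a tuple shorter than the rank; then `x` would lie in the Frattini subgroup. -/
theorem exists_closure_insert_eq_top {G : Type*} [Group G] [Finite G] [Nontrivial G]
    (h : psi G = Group.rank G) {x : G} (hx : x ∉ frattini G) :
    ∃ z : Fin (Group.rank G - 1) → G, Subgroup.closure (insert x (Set.range z)) = ⊤ := by
  obtain ⟨h1, h2⟩ := psi_spec G
  rw [h] at h1 h2
  by_contra! hz
  refine hx (equivM_one_iff.1 ((h2 x 1).1 fun z => ⟨fun hc => (hz z hc).elim, fun hc => ?_⟩))
  have hc' : Subgroup.closure (Set.range z) = ⊤ := by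
    rw [← hc, Subgroup.closure_insert_one]
  have := rank_le_iff_exists_tuple.2 ⟨_, hc'⟩
  omega

theorem closure_image_eq_top_iff {G Q : Type*} [Group G] [Group Q] [Finite G] (f : G →* Q)
    (hf : Function.Surjective f) (hk : f.ker ≤ frattini G) (S : Set G) :
    Subgroup.closure (f '' S) = ⊤ ↔ Subgroup.closure S = ⊤ := by
  rw [← MonoidHom.map_closure]
  constructor
  · intro h
    refine frattini_nongenerating (top_le_iff.1 ?_)
    have := Subgroup.comap_map_eq f (Subgroup.closure S)
    rw [h, Subgroup.comap_top] at this
    exact this.le.trans (sup_le_sup_left hk _)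
  · intro h
    rw [h, ← MonoidHom.range_eq_map, MonoidHom.range_eq_top.2 hf]

/-- Every maximal subgroup contains the kernel, and elements of the kernel are nongenerators, so
both relations can be tested in the quotient. -/
theorem psi_le_of_surjective {G Q : Type*} [Group G] [Group Q] [Finite G] (f : G →* Q)
    (hf : Function.Surjective f) (hk : f.ker ≤ frattini G) {r : ℕ} (hr : 1 ≤ r)
    (h : ∀ x y : Q, EquivMr r x y → EquivM x y) : psi G ≤ r := by
  refine psi_le hr fun x y hxy => ?_
  have h1 : EquivMr r (f x) (f y) := by
    intro z
    choose w hw using fun i => hf (z i)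
    have hz : z = f ∘ w := (funext hw).symm
    rw [hz, Set.range_comp, ← Set.image_insert_eq, ← Set.image_insert_eq,
      closure_image_eq_top_iff f hf hk, closure_image_eq_top_iff f hf hk]
    exact hxy w
  intro M hM
  have hker : f.ker ≤ M := hk.trans (frattini_le_coatom hM)
  have hcomap : (M.map f).comap f = M := by rw [Subgroup.comap_map_eq, sup_eq_left.2 hker]
  have hM' : IsCoatom (M.map f) := by
    refine ⟨fun ht => hM.1 (by rw [← hcomap, ht, Subgroup.comap_top]), fun N hN => ?_⟩
    have hlt : M < N.comap f := by
      rw [← hcomap]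
      exact (Subgroup.comap_lt_comap_of_surjective hf).2 hN
    rw [← Subgroup.map_comap_eq_self_of_surjective hf N, hM.2 _ hlt, ← MonoidHom.range_eq_map,
      MonoidHom.range_eq_top.2 hf]
  have := h _ _ h1 _ hM'
  rwa [← Subgroup.mem_comap, ← Subgroup.mem_comap, hcomap] at this

/-- A one-sided criterion: it suffices to separate an element outside a maximal subgroup from
those inside by generators chosen in the maximal subgroup. -/
theorem equivM_of_equivMr {G : Type*} [Group G] {r : ℕ}
    (h : ∀ (M : Subgroup G), IsCoatom M → ∀ x ∉ M,
      ∃ z : Fin (r - 1) → G, (∀ i, z i ∈ M) ∧ Subgroup.closure (insert x (Set.range z)) = ⊤)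
    {x y : G} (hxy : EquivMr r x y) : EquivM x y := by
  have key : ∀ x y : G, EquivMr r x y → ∀ M : Subgroup G, IsCoatom M → y ∈ M → x ∈ M := by
    intro x y hxy M hM hy
    by_contra hx
    obtain ⟨z, hzM, hz⟩ := h M hM x hx
    have hc := (hxy z).1 hz
    refine hM.1 (top_le_iff.1 (hc ▸ (Subgroup.closure_le M).2 ?_))
    rintro g (rfl | ⟨i, rfl⟩)
    exacts [hy, hzM i]
  exact fun M hM => ⟨key y x (fun z => (hxy z).symm) M hM, key x y hxy M hM⟩

/-! ### Abelian minimal normal subgroups and generation of soluble groups -/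

/-- An abelian minimal normal subgroup. -/
structure IsAbelianMinimalNormal {G : Type*} [Group G] (A : Subgroup G) : Prop where
  normal : A.Normal
  ne_bot : A ≠ ⊥
  minimal : ∀ N : Subgroup G, N.Normal → N ≤ A → N = ⊥ ∨ N = A
  comm : ∀ a ∈ A, ∀ b ∈ A, a * b = b * a

theorem exists_isAbelianMinimalNormal (G : Type*) [Group G] [Finite G] [Nontrivial G]
    [Group.IsSolvable G] : ∃ A : Subgroup G, IsAbelianMinimalNormal A := by
  obtain ⟨A, hA⟩ := (Set.toFinite {A : Subgroup G | A.Normal ∧ A ≠ ⊥}).exists_minimal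
    ⟨⊤, inferInstance, top_ne_bot⟩
  have hmin : ∀ N : Subgroup G, N.Normal → N ≤ A → N = ⊥ ∨ N = A := by
    intro N hN hNA
    by_contra! h
    exact h.2 (le_antisymm hNA (hA.2 ⟨hN, h.1⟩ hNA))
  have hn : A.Normal := hA.1.1
  refine ⟨A, hn, hA.1.2, hmin, ?_⟩
  have hlt := Group.IsSolvable.commutator_lt_of_ne_bot hA.1.2
  have hbot : ⁅A, A⁆ = ⊥ := (hmin _ inferInstance hlt.le).resolve_right hlt.ne
  intro a ha b hb
  have := Subgroup.commutator_eq_bot_iff_le_centralizer.1 hbot ha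
  exact (Subgroup.mem_centralizer_iff.1 this b hb).symm

theorem IsAbelianMinimalNormal.exists_prime_pow_eq_one {G : Type*} [Group G] [Finite G]
    {A : Subgroup G} (hA : IsAbelianMinimalNormal A) :
    ∃ p : ℕ, p.Prime ∧ ∀ a ∈ A, a ^ p = 1 := by
  have hcard : Nat.card A ≠ 1 := fun h => hA.ne_bot (Subgroup.card_eq_one.1 h)
  obtain ⟨p, hp, hdvd⟩ := Nat.exists_prime_and_dvd hcard
  have := Fact.mk hp
  refine ⟨p, hp, ?_⟩
  let N : Subgroup G :=
    { carrier := {a | a ∈ A ∧ a ^ p = 1}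
      one_mem' := ⟨A.one_mem, one_pow p⟩
      mul_mem' := fun {a b} ha hb => ⟨A.mul_mem ha.1 hb.1, by
        rw [(show Commute a b from hA.comm a ha.1 b hb.1).mul_pow, ha.2, hb.2, one_mul]⟩
      inv_mem' := fun {a} ha => ⟨A.inv_mem ha.1, by rw [inv_pow, ha.2, inv_one]⟩ }
  have hN : N.Normal :=
    ⟨fun a ha g => ⟨hA.normal.conj_mem a ha.1 g, by rw [conj_pow, ha.2, mul_one, mul_inv_cancel]⟩⟩
  rcases hA.minimal N hN (fun a ha => ha.1) with h | h
  · obtain ⟨a, ha⟩ := exists_prime_orderOf_dvd_card' p hdvd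
    have h1 : (a : G) ∈ N := ⟨a.2, by
      rw [← Subgroup.coe_pow, ← ha, pow_orderOf_eq_one, Subgroup.coe_one]⟩
    rw [h, Subgroup.mem_bot, OneMemClass.coe_eq_one] at h1
    rw [h1, orderOf_one] at ha
    exact (hp.one_lt.ne ha).elim
  · exact fun a ha => (h ▸ ha : a ∈ N).2

/-- `S ⊓ A` is normalised by `S`, and centralised by `A` since `A` is abelian; hence it is normal,
and minimality applies. -/
theorem IsAbelianMinimalNormal.eq_top_or_inf_eq_bot {G : Type*} [Group G]
    {A : Subgroup G} (hA : IsAbelianMinimalNormal A) {S : Subgroup G} (hS : S ⊔ A = ⊤) :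
    S = ⊤ ∨ S ⊓ A = ⊥ := by
  have := hA.normal
  have hN : (S ⊓ A).Normal := by
    refine ⟨fun n hn g => ⟨?_, hA.normal.conj_mem n hn.2 g⟩⟩
    obtain ⟨s, hs, a, ha, rfl⟩ := Subgroup.mem_sup_of_normal_right.1
      (hS ▸ Subgroup.mem_top g : g ∈ S ⊔ A)
    have : s * a * n * (s * a)⁻¹ = s * n * s⁻¹ := by
      rw [mul_assoc s a n, hA.comm a ha n hn.2]
      group
    rw [this]
    exact S.mul_mem (S.mul_mem hs hn.1) (S.inv_mem hs)
  rcases hA.minimal _ hN inf_le_right with h | h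
  · exact Or.inr h
  · left
    rw [← hS, left_eq_sup]
    exact h ▸ inf_le_left

theorem eq_of_le_of_sup_eq_top {G : Type*} [Group G] {A T Y : Subgroup G} [A.Normal]
    (hTY : T ≤ Y) (hT : T ⊔ A = ⊤) (hY : Y ⊓ A = ⊥) : T = Y := by
  refine le_antisymm hTY fun y hy => ?_
  obtain ⟨t, ht, a, ha, rfl⟩ := Subgroup.mem_sup_of_normal_right.1
    (hT ▸ Subgroup.mem_top y : y ∈ T ⊔ A)
  have : a ∈ Y ⊓ A := ⟨(Subgroup.mul_mem_cancel_left Y (hTY ht)).1 hy, ha⟩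
  rw [hY, Subgroup.mem_bot] at this
  rwa [this, mul_one]

theorem closure_range_mul_sup {G : Type*} [Group G] {m : ℕ} {A : Subgroup G}
    (z : Fin m → G) (b : Fin m → A) :
    Subgroup.closure (Set.range z) ≤
      Subgroup.closure (Set.range fun i => z i * (b i : G)) ⊔ A := by
  rw [Subgroup.closure_le]
  rintro _ ⟨i, rfl⟩
  have h1 : z i * (b i : G) ∈ Subgroup.closure (Set.range fun i => z i * (b i : G)) ⊔ A :=
    Subgroup.mem_sup_left (Subgroup.subset_closure ⟨i, rfl⟩)
  exact (Subgroup.mul_mem_cancel_right _ (Subgroup.mem_sup_right (b i).2)).1 h1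

/-- Generators modulo an abelian minimal normal subgroup `A` can be corrected by elements of `A`
while one extra generator is kept fixed. -/
theorem IsAbelianMinimalNormal.exists_correction {G : Type*} [Group G] [Finite G]
    {A : Subgroup G} (hA : IsAbelianMinimalNormal A) {m : ℕ} (hm : Group.rank G ≤ m)
    (x : G) (w : Fin m → G) (hw : Subgroup.closure (insert x (Set.range w)) ⊔ A = ⊤) :
    ∃ a : Fin m → A, Subgroup.closure (insert x (Set.range fun i => w i * (a i : G))) = ⊤ := by
  have := hA.normal
  obtain ⟨z, hz⟩ := rank_le_iff_exists_tuple.1 hm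
  -- If no correction works, every `Y a` below is a complement of `A`. A counting argument on tuples
  -- then yields a contradiction.
  by_contra! hne
  set Y : (Fin m → A) → Subgroup G :=
    fun a => Subgroup.closure (insert x (Set.range fun i => w i * (a i : G))) with hYdef
  have hwY : ∀ a i, w i * (a i : G) ∈ Y a := fun a i =>
    Subgroup.subset_closure (Set.mem_insert_of_mem _ ⟨i, rfl⟩)
  have hsup : ∀ a, Y a ⊔ A = ⊤ := by
    intro a
    rw [eq_top_iff, ← hw]
    refine sup_le ((Subgroup.closure_le _).2 ?_) le_sup_right
    rintro g (rfl | ⟨i, rfl⟩)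
    · exact Subgroup.mem_sup_left (Subgroup.subset_closure (Set.mem_insert _ _))
    · exact (Subgroup.mul_mem_cancel_right _ (Subgroup.mem_sup_right (a i).2)).1
        (Subgroup.mem_sup_left (hwY a i))
  have hinf : ∀ a, Y a ⊓ A = ⊥ := fun a =>
    (hA.eq_top_or_inf_eq_bot (hsup a)).resolve_left (hne a)
  have hb : ∀ (a : Fin m → A) (i : Fin m), ∃ b : A, z i * (b : G) ∈ Y a := by
    intro a i
    obtain ⟨s, hs, c, hc, h⟩ := Subgroup.mem_sup_of_normal_right.1
      (hsup a ▸ Subgroup.mem_top (z i) : z i ∈ Y a ⊔ A)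
    refine ⟨⟨c, hc⟩⁻¹, ?_⟩
    rw [← h]
    simpa using hs
  choose b hb using hb
  -- The corrected generators `z i * b a i` already supplement `A`, so they generate the whole
  -- complement `Y a`; thus `b a` determines `Y a`.
  have hcl : ∀ a, Subgroup.closure (Set.range fun i => z i * (b a i : G)) = Y a := by
    intro a
    refine eq_of_le_of_sup_eq_top (A := A) ((Subgroup.closure_le _).2 ?_) ?_ (hinf a)
    · rintro _ ⟨i, rfl⟩
      exact hb a i
    · rw [eq_top_iff, ← hz]
      exact closure_range_mul_sup z (b a)
  have hinj : Function.Injective b := by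
    intro a a' h
    have hY : Y a = Y a' := by rw [← hcl a, ← hcl a', h]
    funext i
    have h1 : (w i * (a i : G))⁻¹ * (w i * (a' i : G)) ∈ Y a :=
      (Y a).mul_mem ((Y a).inv_mem (hwY a i)) (hY ▸ hwY a' i)
    have h2 : (w i * (a i : G))⁻¹ * (w i * (a' i : G)) = ((a i)⁻¹ * a' i : A) := by
      push_cast
      group
    rw [h2] at h1
    have h3 : (((a i)⁻¹ * a' i : A) : G) ∈ Y a ⊓ A := ⟨h1, ((a i)⁻¹ * a' i).2⟩
    rw [hinf a, Subgroup.mem_bot, OneMemClass.coe_eq_one, inv_mul_eq_one] at h3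
    exact h3
  -- An injective self-map of the finite set of tuples takes the value `1`; that complement contains
  -- every `z i`, hence is `G`.
  obtain ⟨a, ha⟩ := (Finite.injective_iff_surjective.1 hinj) 1
  refine hne a (top_le_iff.1 (hz ▸ (Subgroup.closure_le _).2 ?_))
  rintro _ ⟨i, rfl⟩
  have := hb a i
  rw [ha] at this
  simpa using this

/-- In a finite soluble group `G`, a maximal subgroup `M` contains `rank G` elements which generate
`G` together with any given element outside `M`. -/
theorem exists_tuple_mem_closure_insert_eq_top {n : ℕ} : ∀ {G : Type*} [Group G] [Finite G]
    [Group.IsSolvable G] (_ : Nat.card G = n) {m : ℕ} (_ : Group.rank G ≤ m)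
    {M : Subgroup G} (_ : IsCoatom M) {x : G} (_ : x ∉ M),
    ∃ z : Fin m → G, (∀ i, z i ∈ M) ∧ Subgroup.closure (insert x (Set.range z)) = ⊤ := by
  induction n using Nat.strong_induction_on with
  | _ n ih =>
  intro G _ _ _ hn m hm M hM x hx
  have : Nontrivial G := ⟨x, 1, fun h => hx (h ▸ M.one_mem)⟩
  obtain ⟨A, hA⟩ := exists_isAbelianMinimalNormal G
  have := hA.normal
  have hf : Function.Surjective (QuotientGroup.mk' A) := QuotientGroup.mk'_surjective A
  have hrank : Group.rank (G ⧸ A) ≤ m := (Group.rank_le_of_surjective _ hf).trans hm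
  by_cases hAM : A ≤ M
  · have hcomap : (M.map (QuotientGroup.mk' A)).comap (QuotientGroup.mk' A) = M := by
      rw [Subgroup.comap_map_eq, QuotientGroup.ker_mk', sup_eq_left.2 hAM]
    have hM' : IsCoatom (M.map (QuotientGroup.mk' A)) := by
      refine ⟨fun ht => hM.1 (by rw [← hcomap, ht, Subgroup.comap_top]), fun N hN => ?_⟩
      have hlt : M < N.comap (QuotientGroup.mk' A) := by
        rw [← hcomap]
        exact (Subgroup.comap_lt_comap_of_surjective hf).2 hN
      rw [← Subgroup.map_comap_eq_self_of_surjective hf N, hM.2 _ hlt, ← MonoidHom.range_eq_map,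
        MonoidHom.range_eq_top.2 hf]
    have hx' : QuotientGroup.mk' A x ∉ M.map (QuotientGroup.mk' A) := by
      rwa [← Subgroup.mem_comap, hcomap]
    have hlt : Nat.card (G ⧸ A) < n := by
      rw [← hn, Subgroup.card_eq_card_quotient_mul_card_subgroup A]
      have h1 : 1 < Nat.card A := (Subgroup.one_lt_card_iff_ne_bot A).2 hA.ne_bot
      have h2 : 0 < Nat.card (G ⧸ A) := Nat.card_pos
      nlinarith
    obtain ⟨z, hzM, hz⟩ := ih _ hlt rfl hrank hM' hx'
    choose w hwM hw using hzM
    have hgen : Subgroup.closure (insert x (Set.range w)) ⊔ A = ⊤ := by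
      have hzw : z = QuotientGroup.mk' A ∘ w := (funext hw).symm
      rw [hzw, Set.range_comp, ← Set.image_insert_eq, ← MonoidHom.map_closure] at hz
      have := Subgroup.comap_map_eq (QuotientGroup.mk' A)
        (Subgroup.closure (insert x (Set.range w)))
      rw [hz, Subgroup.comap_top, QuotientGroup.ker_mk'] at this
      exact this.symm
    obtain ⟨a, ha⟩ := hA.exists_correction hm x w hgen
    exact ⟨_, fun i => M.mul_mem (hwM i) (hAM (a i).2), ha⟩
  -- Here `M` is a complement of `A`, so `M ≅ G/A` is itself generated by `m` elements, and
  -- maximality does the rest.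
  · have hsup : M ⊔ A = ⊤ := hM.2 _ (left_lt_sup.2 hAM)
    have hinf : M ⊓ A = ⊥ := (hA.eq_top_or_inf_eq_bot hsup).resolve_left hM.1
    obtain ⟨z, hz⟩ := rank_le_iff_exists_tuple.1 hrank
    have hlift : ∀ i, ∃ w ∈ M, QuotientGroup.mk' A w = z i := by
      intro i
      obtain ⟨g, hg⟩ := hf (z i)
      obtain ⟨w, hw, a, ha, rfl⟩ := Subgroup.mem_sup_of_normal_right.1
        (hsup ▸ Subgroup.mem_top g : g ∈ M ⊔ A)
      refine ⟨w, hw, ?_⟩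
      rw [← hg, map_mul, (QuotientGroup.eq_one_iff a).2 ha |> fun h => (h : QuotientGroup.mk' A a = 1),
        mul_one]
    choose w hwM hw using hlift
    have hzw : z = QuotientGroup.mk' A ∘ w := (funext hw).symm
    have hgen : Subgroup.closure (Set.range w) ⊔ A = ⊤ := by
      rw [hzw, Set.range_comp, ← MonoidHom.map_closure] at hz
      have := Subgroup.comap_map_eq (QuotientGroup.mk' A) (Subgroup.closure (Set.range w))
      rw [hz, Subgroup.comap_top, QuotientGroup.ker_mk'] at this
      exact this.symm
    have hcl : Subgroup.closure (Set.range w) = M := by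
      refine eq_of_le_of_sup_eq_top (A := A) ((Subgroup.closure_le _).2 ?_) hgen hinf
      rintro _ ⟨i, rfl⟩
      exact hwM i
    refine ⟨w, hwM, hM.2 _ (lt_of_le_of_ne ?_ fun h => hx ?_)⟩
    · rw [← hcl]
      exact Subgroup.closure_mono (Set.subset_insert _ _)
    · rw [h]
      exact Subgroup.subset_closure (Set.mem_insert _ _)

/-! ### Irreducible actions and cocycles -/

section Action

variable {H V : Type*} [Group H] [AddCommGroup V] [DistribMulAction H V]

variable (H V) in
/-- The action of `H` on the additive group `V` is irreducible. -/
structure IsIrred : Prop where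
  nontrivial : Nontrivial V
  eq_bot_or_eq_top : ∀ W : AddSubgroup V, (∀ (h : H), ∀ w ∈ W, h • w ∈ W) → W = ⊥ ∨ W = ⊤

/-- The ring `K` maps onto the ring of all additive endomorphisms of `V` commuting with `H`. -/
def IsFullEnd (H V K : Type*) [Group H] [AddCommGroup V] [DistribMulAction H V] [Ring K]
    [Module K V] : Prop :=
  ∀ f : V →+ V, (∀ (h : H) (v : V), f (h • v) = h • f v) → ∃ c : K, ∀ v, f v = c • v

/-- A proper `H`-stable subgroup of `V^n` satisfies a nontrivial linear relation over `End_H(V)`. -/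
theorem exists_relation {K : Type*} [Ring K] [Module K V] [Finite V]
    (hirr : IsIrred H V) (hK : IsFullEnd H V K) {n : ℕ} (T : AddSubgroup (Fin n → V))
    (hT : ∀ (h : H), ∀ t ∈ T, h • t ∈ T) (hne : T ≠ ⊤) :
    ∃ c : Fin n → K, c ≠ 0 ∧ ∀ t ∈ T, ∑ i, c i • t i = 0 := by
  classical
  -- A maximal proper `H`-stable subgroup `T'` is complemented by some coordinate copy of `V`. The
  -- projection `π` onto that copy along `T'` commutes with `H`, so its components are the scalars
  -- `c`.
  obtain ⟨T', hTT', hmax⟩ := (Set.toFinite {T : AddSubgroup (Fin n → V) |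
    (∀ (h : H), ∀ t ∈ T, h • t ∈ T) ∧ T ≠ ⊤}).exists_le_maximal ⟨hT, hne⟩
  obtain ⟨j, v₀, hv₀⟩ : ∃ j v, Pi.single j v ∉ T' := by
    by_contra! h
    refine hmax.1.2 (eq_top_iff.2 fun t _ => ?_)
    rw [← Finset.univ_sum_single t]
    exact T'.sum_mem fun i _ => h i (t i)
  have hsmul : ∀ (h : H) (v : V), h • (Pi.single j v : Fin n → V) = Pi.single j (h • v) := by
    intro h v
    funext i
    by_cases hi : i = j
    · subst hi
      simp
    · simp [hi]
  have hU : ∀ v, Pi.single j v ∈ T' → v = 0 := by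
    rcases hirr.eq_bot_or_eq_top (T'.comap (AddMonoidHom.single (fun _ => V) j))
      (fun h w hw => by
        have := hmax.1.1 h _ hw
        rwa [AddMonoidHom.single_apply, hsmul] at this) with h | h
    · intro v hv
      have : v ∈ T'.comap (AddMonoidHom.single (fun _ => V) j) := hv
      rwa [h, AddSubgroup.mem_bot] at this
    · exact (hv₀ (h ▸ AddSubgroup.mem_top v₀ :
        v₀ ∈ T'.comap (AddMonoidHom.single (fun _ => V) j))).elim
  have hsup : T' ⊔ (AddMonoidHom.single (fun _ => V) j).range = ⊤ := by
    by_contra hne'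
    have hle := hmax.2 (y := T' ⊔ (AddMonoidHom.single (fun _ => V) j).range) ⟨?_, hne'⟩ le_sup_left
    · exact hv₀ (hle (AddSubgroup.mem_sup_right ⟨v₀, rfl⟩))
    · intro h t ht
      obtain ⟨a, ha, _, ⟨v, rfl⟩, rfl⟩ := AddSubgroup.mem_sup.1 ht
      rw [smul_add, AddMonoidHom.single_apply, hsmul]
      exact add_mem (AddSubgroup.mem_sup_left (hmax.1.1 h a ha))
        (AddSubgroup.mem_sup_right ⟨h • v, rfl⟩)
  have hdec : ∀ t : Fin n → V, ∃ v, t - Pi.single j v ∈ T' := by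
    intro t
    obtain ⟨a, ha, _, ⟨v, rfl⟩, rfl⟩ := AddSubgroup.mem_sup.1
      (hsup ▸ AddSubgroup.mem_top t : t ∈ T' ⊔ (AddMonoidHom.single (fun _ => V) j).range)
    exact ⟨v, by simpa using ha⟩
  choose π hπ using hdec
  have huniq : ∀ t v, t - Pi.single j v ∈ T' → π t = v := by
    intro t v hv
    rw [← sub_eq_zero]
    refine hU _ ?_
    have := T'.sub_mem hv (hπ t)
    rwa [sub_sub_sub_cancel_left, ← Pi.single_sub] at this
  have hadd : ∀ s t, π (s + t) = π s + π t := by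
    intro s t
    refine huniq _ _ ?_
    rw [Pi.single_add, add_sub_add_comm]
    exact T'.add_mem (hπ s) (hπ t)
  have hequiv : ∀ (h : H) t, π (h • t) = h • π t := by
    intro h t
    refine huniq _ _ ?_
    rw [← hsmul, ← smul_sub]
    exact hmax.1.1 h _ (hπ t)
  let πh : (Fin n → V) →+ V := AddMonoidHom.mk' π hadd
  have hc : ∀ i, ∃ c : K, ∀ v, π (Pi.single i v) = c • v := fun i =>
    hK (πh.comp (AddMonoidHom.single (fun _ => V) i)) fun h v => by
      change π (Pi.single i (h • v)) = h • π (Pi.single i v)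
      rw [← hequiv, ← Pi.single_smul]
  choose c hc using hc
  refine ⟨c, fun h0 => hv₀ ?_, fun t ht => ?_⟩
  · have h1 : π (Pi.single j v₀) = v₀ := huniq _ _ (by simp [T'.zero_mem])
    rw [hc, h0, Pi.zero_apply, zero_smul] at h1
    rw [← h1, Pi.single_zero]
    exact T'.zero_mem
  · have h1 : πh t = 0 := huniq _ _ (by simpa using hTT' ht)
    rw [← h1, ← Finset.univ_sum_single t, map_sum]
    refine Finset.sum_congr rfl fun i _ => ?_
    rw [Finset.univ_sum_single t]
    exact (hc i (t i)).symm

/-- Normality of `N` makes its fixed vectors an `H`-stable subgroup, and faithfulness prevents this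
from being all of `V`. -/
theorem IsIrred.eq_zero_of_fixed (hirr : IsIrred H V) [FaithfulSMul H V] {N : Subgroup H}
    (hN : N.Normal) (hbot : N ≠ ⊥) {v : V} (hv : ∀ h ∈ N, h • v = v) : v = 0 := by
  let W : AddSubgroup V :=
    { carrier := {v | ∀ h ∈ N, h • v = v}
      zero_mem' := fun h _ => smul_zero h
      add_mem' := fun {a b} ha hb h hh => by rw [smul_add, ha h hh, hb h hh]
      neg_mem' := fun {a} ha h hh => by rw [smul_neg, ha h hh] }
  rcases hirr.eq_bot_or_eq_top W (fun g w hw h hh => by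
    have := hw _ (hN.conj_mem h hh g⁻¹)
    rw [inv_inv, mul_smul, mul_smul, inv_smul_eq_iff] at this
    exact this) with h | h
  · have : v ∈ W := hv
    rwa [h, AddSubgroup.mem_bot] at this
  · refine (hbot ((Subgroup.eq_bot_iff_forall N).2 fun g hg => ?_)).elim
    refine FaithfulSMul.eq_of_smul_eq_smul (α := V) fun w => ?_
    rw [one_smul]
    exact (h ▸ AddSubgroup.mem_top w : w ∈ W) g hg

theorem IsIrred.eq_zero_of_forall_smul_eq (hirr : IsIrred H V) [FaithfulSMul H V] [Nontrivial H]
    {v : V} (hv : ∀ h : H, h • v = v) : v = 0 :=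
  hirr.eq_zero_of_fixed (N := ⊤) inferInstance top_ne_bot fun h _ => hv h

/-- The first cohomology of a finite soluble group with coefficients in a nontrivial faithful
irreducible module vanishes. -/
theorem IsIrred.exists_eq_smul_sub (hirr : IsIrred H V) [FaithfulSMul H V] [Nontrivial H]
    [Finite H] [Group.IsSolvable H] [Finite V] {p : ℕ} (hp : p.Prime) (hpV : ∀ v : V, p • v = 0)
    (f : H → V) (hf : ∀ g h, f (g * h) = f g + g • f h) : ∃ u, ∀ h, f h = h • u - u := by
  classical
  obtain ⟨A, hA⟩ := exists_isAbelianMinimalNormal H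
  obtain ⟨q, hq, hAq⟩ := hA.exists_prime_pow_eq_one
  have hfix : ∀ v : V, (∀ h ∈ A, h • v = v) → v = 0 := fun v hv =>
    hirr.eq_zero_of_fixed hA.normal hA.ne_bot hv
  have hgrp : IsPGroup q A := fun a => ⟨1, by
    rw [pow_one]
    exact Subtype.ext (by simpa using hAq a a.2)⟩
  have := Fact.mk hp
  have := Fact.mk hq
  -- A `q`-group acting on a nonzero `q`-group fixes a nonzero vector, which is excluded for `A`.
  have hqp : q ≠ p := by
    rintro rfl
    have := hirr.nontrivial
    obtain ⟨v, hv⟩ := exists_ne (0 : V)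
    have hdvd : q ∣ Nat.card V := by
      rw [← addOrderOf_eq_prime (hpV v) hv]
      exact addOrderOf_dvd_natCard v
    obtain ⟨w, hw, hw0⟩ := hgrp.exists_fixed_point_of_prime_dvd_card_of_fixed_point V hdvd
      (a := 0) (fun a => smul_zero a)
    exact hw0 (hfix w fun h hh => hw ⟨h, hh⟩).symm
  obtain ⟨k, hk⟩ := IsPGroup.iff_card.1 hgrp
  have hcop : Nat.Coprime (Nat.card A) p := by
    rw [hk]
    exact Nat.Coprime.pow_left _ ((Nat.coprime_primes hq hp).2 hqp)
  obtain ⟨m, hm⟩ : ∃ m : ℤ, ∀ v : V, m • (Nat.card A • v) = v := by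
    refine ⟨Nat.gcdA (Nat.card A) p, fun v => ?_⟩
    have h1 := Nat.gcd_eq_gcd_ab (Nat.card A) p
    rw [hcop, Nat.cast_one] at h1
    calc _ = ((Nat.card A : ℤ) * Nat.gcdA (Nat.card A) p +
          p * Nat.gcdB (Nat.card A) p) • v := by
          rw [add_smul, mul_comm (p : ℤ), mul_smul _ (p : ℤ) v, natCast_zsmul v p, hpV, smul_zero,
            add_zero, mul_comm, mul_smul, natCast_zsmul]
      _ = v := by rw [← h1, one_smul]
  have := Fintype.ofFinite A
  -- Averaging over `A`, whose order is invertible on `V`, makes `f` principal on `A`.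
  set s : V := ∑ a : A, f a with hs
  have hsum : ∀ b : A, Nat.card A • f b = s - b • s := by
    intro b
    rw [eq_sub_iff_add_eq]
    calc Nat.card A • f b + b • s = ∑ a : A, (f b + (b : H) • f a) := by
          rw [Finset.sum_add_distrib, Finset.sum_const, Finset.card_univ, Nat.card_eq_fintype_card,
            hs, Finset.smul_sum]
          rfl
      _ = ∑ a : A, f ((b * a : A) : H) := Finset.sum_congr rfl fun a _ => by
          rw [Subgroup.coe_mul, hf]
      _ = s := Fintype.sum_equiv (Equiv.mulLeft b) _ _ fun a => rfl
  set u : V := -(m • s) with hu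
  have hfA : ∀ b ∈ A, f b = b • u - u := by
    intro b hb
    have h1 := hsum ⟨b, hb⟩
    rw [Subgroup.mk_smul] at h1
    rw [← hm (f b), h1, smul_sub, hu, smul_neg, smul_comm m b s]
    abel
  -- Computing `f (b * h) = f (h * (h⁻¹ * b * h))` in two ways shows that `f h - (h • u - u)` is
  -- fixed by `A`, hence zero.
  refine ⟨u, fun h => ?_⟩
  rw [← sub_eq_zero]
  refine hfix _ fun b hb => ?_
  have h1 : b * h = h * (h⁻¹ * b * h) := by group
  have h2 : f (h⁻¹ * b * h) = (h⁻¹ * b * h) • u - u := hfA _ (by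
    simpa using hA.normal.conj_mem b hb h⁻¹)
  have h3 := hf b h
  rw [h1, hf, h2, hfA b hb, smul_sub, ← mul_smul, ← h1, mul_smul] at h3
  rw [smul_sub, smul_sub]
  have h4 : b • f h = f h + (b • h • u - h • u) - (b • u - u) := by rw [h3]; abel
  rw [h4]
  abel

end Action

/-! ### Vectors with few linear relations modulo the range of a map -/

section LinearAlgebra

variable {K U E : Type*} [DivisionRing K] [AddCommGroup U] [Module K U] [AddCommGroup E]
  [Module K E] [Module.Finite K E]

theorem exists_independent_mod_range (b : U →ₗ[K] E) {n : ℕ}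
    (hn : n + Module.finrank K (LinearMap.range b) ≤ Module.finrank K E) :
    ∃ w : Fin n → E, ∀ (c : Fin n → K) (u : U), ∑ j, c j • w j = b u → c = 0 := by
  have hq := (LinearMap.range b).finrank_quotient_add_finrank
  obtain ⟨f, hf⟩ := exists_linearIndependent_of_le_finrank
    (show n ≤ Module.finrank K (E ⧸ LinearMap.range b) by omega)
  choose w hw using fun i => (LinearMap.range b).mkQ_surjective (f i)
  refine ⟨w, fun c u h => funext (Fintype.linearIndependent_iff.1 hf c ?_)⟩
  have h1 := congrArg (LinearMap.range b).mkQ h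
  rw [map_sum] at h1
  simp only [map_smul, hw] at h1
  rw [h1]
  exact (Submodule.Quotient.mk_eq_zero _).2 ⟨u, rfl⟩

/-- There is room for `n - 1` vectors independent modulo the range. The remaining one, at an index
where `c` is nonzero, is found by solving the prescribed relation. -/
theorem exists_unique_relation_mod_range (b : U →ₗ[K] E) {n : ℕ}
    (hn : n + Module.finrank K (LinearMap.range b) ≤ Module.finrank K E + 1)
    {c : Fin n → K} (hc : c ≠ 0) (u : U) :
    ∃ w : Fin n → E, ∑ j, c j • w j = b u ∧
      ∀ (c' : Fin n → K) (u' : U), ∑ j, c' j • w j = b u' → ∃ k : K, c' = k • c := by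
  obtain ⟨j₀, hj₀⟩ : ∃ j, c j ≠ 0 := by
    by_contra! h
    exact hc (funext h)
  obtain ⟨n, rfl⟩ : ∃ n', n = n' + 1 := ⟨n - 1, by have := j₀.pos; omega⟩
  obtain ⟨w, hw⟩ := exists_independent_mod_range b
    (show n + Module.finrank K (LinearMap.range b) ≤ Module.finrank K E by omega)
  set w' : Fin (n + 1) → E := j₀.insertNth
    ((c j₀)⁻¹ • (b u - ∑ i, c (j₀.succAbove i) • w i)) w with hw'
  have h0 : w' j₀ = (c j₀)⁻¹ • (b u - ∑ i, c (j₀.succAbove i) • w i) :=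
    Fin.insertNth_apply_same (α := fun _ => E) _ _ _
  have hs : ∀ i, w' (j₀.succAbove i) = w i := fun i =>
    Fin.insertNth_apply_succAbove (α := fun _ => E) _ _ _ _
  have hrel : ∑ j, c j • w' j = b u := by
    rw [Fin.sum_univ_succAbove _ j₀, h0, smul_inv_smul₀ hj₀]
    simp only [hs]
    abel
  refine ⟨w', hrel, fun c' u' h => ⟨c' j₀ * (c j₀)⁻¹, ?_⟩⟩
  set k : K := c' j₀ * (c j₀)⁻¹ with hk
  have hk0 : (c' - k • c) j₀ = 0 := by
    rw [Pi.sub_apply, Pi.smul_apply, smul_eq_mul, hk, inv_mul_cancel_right₀ hj₀, sub_self]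
  have hsub : ∑ j, (c' - k • c) j • w' j = b (u' - k • u) := by
    rw [map_sub, map_smul, ← h, ← hrel, Finset.smul_sum, ← Finset.sum_sub_distrib]
    refine Finset.sum_congr rfl fun j _ => ?_
    rw [Pi.sub_apply, sub_smul, Pi.smul_apply, smul_eq_mul, mul_smul]
  rw [Fin.sum_univ_succAbove _ j₀, hk0, zero_smul, zero_add] at hsub
  simp only [hs] at hsub
  have hz := hw _ _ hsub
  rw [← sub_eq_zero]
  funext j
  refine j₀.succAboveCases hk0 (fun i => ?_) j
  exact congrFun hz i

end LinearAlgebra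

/-! ### Crossed homomorphisms -/

section Cocycle

variable {H V X : Type*} [Group H] [AddCommGroup V] [DistribMulAction H V] [Group X]
  (K : Type*) [DivisionRing K] [Module K V] [SMulCommClass H K V] (ρ : X →* H)

/-- The space of crossed homomorphisms from `X` to `V`, where `X` acts through `ρ`. -/
def cocycles : Submodule K (X → V) where
  carrier := {f | ∀ x y, f (x * y) = f x + ρ x • f y}
  zero_mem' x y := by simp
  add_mem' {f g} hf hg x y := by
    simp only [Pi.add_apply, hf x y, hg x y, smul_add]
    abel
  smul_mem' c f hf x y := by
    simp only [Pi.smul_apply, hf x y, smul_add, smul_comm (ρ x) c]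

variable (V) in
/-- The principal crossed homomorphism of a vector. -/
def principal : V →ₗ[K] (X → V) where
  toFun u x := ρ x • u - u
  map_add' u v := by
    funext x
    simp only [Pi.add_apply, smul_add]
    abel
  map_smul' c u := by
    funext x
    simp only [Pi.smul_apply, RingHom.id_apply, smul_sub, smul_comm (ρ x) c]

variable {K ρ}

@[simp] theorem principal_apply (u : V) (x : X) : principal V K ρ u x = ρ x • u - u := rfl

theorem principal_mem_cocycles (u : V) : principal V K ρ u ∈ cocycles K ρ := by
  intro x y
  simp only [principal_apply, map_mul, mul_smul, smul_sub]
  abel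

theorem cocycle_one {f : X → V} (hf : f ∈ cocycles K ρ) : f 1 = 0 := by
  have := hf 1 1
  simpa using this

theorem cocycle_inv {f : X → V} (hf : f ∈ cocycles K ρ) (x : X) :
    f x⁻¹ = -((ρ x)⁻¹ • f x) := by
  have := hf x⁻¹ x
  rw [inv_mul_cancel, cocycle_one hf, map_inv] at this
  exact eq_neg_of_add_eq_zero_left this.symm

/-- The zero set of a crossed homomorphism is a subgroup. -/
def cocycleZero (f : X → V) (hf : f ∈ cocycles K ρ) : Subgroup X where
  carrier := {x | f x = 0}
  one_mem' := cocycle_one hf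
  mul_mem' {x y} hx hy := by
    change f (x * y) = 0
    rw [hf, show f x = 0 from hx, show f y = 0 from hy, smul_zero, add_zero]
  inv_mem' {x} hx := by
    change f x⁻¹ = 0
    rw [cocycle_inv hf, show f x = 0 from hx, smul_zero, neg_zero]

theorem mem_cocycleZero {f : X → V} (hf : f ∈ cocycles K ρ) {x : X} :
    x ∈ cocycleZero f hf ↔ f x = 0 := Iff.rfl

theorem cocycle_eq_zero_of_closure {f : X → V} (hf : f ∈ cocycles K ρ) {S : Set X}
    (hS : Subgroup.closure S = ⊤) (h : ∀ s ∈ S, f s = 0) : f = 0 := by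
  funext x
  exact ((Subgroup.closure_le (cocycleZero f hf)).2 h) (hS ▸ Subgroup.mem_top x)

/-- A space of functions on which evaluation at `m` points is injective has small dimension. -/
theorem finrank_le_of_eval_injective {Z : Type*} [Module.Finite K V] (W : Submodule K (Z → V))
    {m : ℕ} (z : Fin m → Z) (h : ∀ f ∈ W, (∀ i, f (z i) = 0) → f = 0) :
    Module.finrank K W ≤ m * Module.finrank K V := by
  have hinj : Function.Injective ((LinearMap.funLeft K V z).domRestrict W) := by
    rw [injective_iff_map_eq_zero]
    intro f hf
    exact Subtype.ext (h f f.2 fun i => congrFun hf i)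
  refine (LinearMap.finrank_le_finrank_of_injective hinj).trans ?_
  rw [Module.finrank_pi_fintype, Finset.sum_const, Finset.card_univ, Fintype.card_fin, smul_eq_mul]

theorem cocycle_eq_of_rho_eq {f : X → V} (hf : f ∈ cocycles K ρ) {Y : Subgroup X}
    (h0 : ∀ y ∈ Y, ρ y = 1 → f y = 0) {x y : X} (hx : x ∈ Y) (hy : y ∈ Y) (hxy : ρ x = ρ y) :
    f x = f y := by
  have h1 : x = x * y⁻¹ * y := by group
  have h2 : ρ (x * y⁻¹) = 1 := by rw [map_mul, map_inv, hxy, mul_inv_cancel]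
  rw [h1, hf, h0 _ (Y.mul_mem hx (Y.inv_mem hy)) h2, h2, one_smul, zero_add]

/-- A crossed homomorphism which on a subgroup `Y` mapping onto `H` factors through `H` is
principal on `Y`. -/
theorem exists_eq_principal_on (hirr : IsIrred H V) [FaithfulSMul H V] [Nontrivial H]
    [Finite H] [Group.IsSolvable H] [Finite V] {p : ℕ} (hp : p.Prime) (hpV : ∀ v : V, p • v = 0)
    {f : X → V} (hf : f ∈ cocycles K ρ) {Y : Subgroup X} (hY : Y.map ρ = ⊤)
    (h0 : ∀ y ∈ Y, ρ y = 1 → f y = 0) : ∃ u, ∀ y ∈ Y, f y = principal V K ρ u y := by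
  have hsec : ∀ h : H, ∃ y ∈ Y, ρ y = h := fun h => by
    have : h ∈ Y.map ρ := hY ▸ Subgroup.mem_top h
    exact this
  -- On `Y` the value of `f` depends only on `ρ`, so `f ∘ s` is a crossed homomorphism on `H`
  -- although `s` is merely a set-theoretic section.
  choose s hsY hs using hsec
  obtain ⟨u, hu⟩ := hirr.exists_eq_smul_sub hp hpV (fun h => f (s h)) fun g h => by
    have : f (s (g * h)) = f (s g * s h) := cocycle_eq_of_rho_eq hf h0 (hsY _)
      (Y.mul_mem (hsY g) (hsY h)) (by rw [map_mul, hs, hs, hs])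
    rw [this, hf, hs]
  refine ⟨u, fun y hy => ?_⟩
  rw [cocycle_eq_of_rho_eq hf h0 hy (hsY (ρ y)) (hs _).symm, hu, principal_apply]

variable (K ρ) in
/-- Linear combinations of given functions and a principal crossed homomorphism. -/
def relMap {n : ℕ} (φ : Fin n → X → V) : (Fin n → K) × V →ₗ[K] (X → V) :=
  (Fintype.linearCombination K φ).coprod (-principal V K ρ)

theorem relMap_apply {n : ℕ} (φ : Fin n → X → V) (c : Fin n → K) (u : V) (x : X) :
    relMap K ρ φ (c, u) x = ∑ j, c j • φ j x - (ρ x • u - u) := by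
  simp [relMap, Fintype.linearCombination_apply, sub_eq_add_neg]

theorem relMap_mem_cocycles {n : ℕ} {φ : Fin n → X → V} (hφ : ∀ j, φ j ∈ cocycles K ρ)
    (a : (Fin n → K) × V) : relMap K ρ φ a ∈ cocycles K ρ := by
  rw [relMap, LinearMap.coprod_apply, Fintype.linearCombination_apply]
  exact add_mem (Submodule.sum_mem _ fun j _ => Submodule.smul_mem _ _ (hφ j))
    (neg_mem (principal_mem_cocycles _))

end Cocycle

/-! ### Extensions of `H` by a power of an irreducible module -/

section PowerExtension

variable {H V X K : Type*} [Group H] [AddCommGroup V] [DistribMulAction H V] [Group X]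
  [DivisionRing K] [Module K V] [SMulCommClass H K V]

/-- The group `X` is identified with `V^n : H` by `ρ : X → H` and crossed homomorphisms `φ j`,
the coordinates in `V^n`. -/
structure IsPowerExtension (K : Type*) [DivisionRing K] [Module K V] [SMulCommClass H K V]
    (ρ : X →* H) {n : ℕ} (φ : Fin n → X → V) : Prop where
  cocycle : ∀ j, φ j ∈ cocycles K ρ
  bijective : Function.Bijective fun x : X => ((fun j => φ j x : Fin n → V), ρ x)

variable {ρ : X →* H} {n : ℕ} {φ : Fin n → X → V}

theorem IsPowerExtension.exists_eq (hX : IsPowerExtension K ρ φ) (w : Fin n → V) (h : H) :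
    ∃ x, (∀ j, φ j x = w j) ∧ ρ x = h := by
  obtain ⟨x, hx⟩ := hX.bijective.2 (w, h)
  exact ⟨x, fun j => congrFun (congrArg Prod.fst hx) j, congrArg Prod.snd hx⟩

theorem IsPowerExtension.exists_tuple (hX : IsPowerExtension K ρ φ) {m : ℕ}
    (w : Fin n → Fin m → V) (h : Fin m → H) :
    ∃ z : Fin m → X, (∀ i j, φ j (z i) = w j i) ∧ ∀ i, ρ (z i) = h i := by
  choose z hz hρ using fun i => hX.exists_eq (fun j => w j i) (h i)
  exact ⟨z, hz, hρ⟩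

theorem IsPowerExtension.map_top (hX : IsPowerExtension K ρ φ) : (⊤ : Subgroup X).map ρ = ⊤ := by
  rw [← MonoidHom.range_eq_map, MonoidHom.range_eq_top]
  intro h
  obtain ⟨x, -, hx⟩ := hX.exists_eq 0 h
  exact ⟨x, hx⟩

/-- On elements over `1` the principal part vanishes, and there the coordinates take arbitrary
values. -/
theorem IsPowerExtension.eq_zero_of_relMap_eq_zero (hX : IsPowerExtension K ρ φ)
    (hirr : IsIrred H V) {c : Fin n → K} {u : V} (h : relMap K ρ φ (c, u) = 0) : c = 0 := by
  classical
  have := hirr.nontrivial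
  obtain ⟨v, hv⟩ := exists_ne (0 : V)
  funext j
  obtain ⟨x, hx, hx1⟩ := hX.exists_eq (Pi.single j v) 1
  have h1 := congrFun h x
  simp only [relMap_apply, hx, hx1, one_smul, sub_self, sub_zero, Pi.single_apply, smul_ite,
    smul_zero, Finset.sum_ite_eq', Finset.mem_univ, if_true, Pi.zero_apply] at h1
  exact (smul_eq_zero.1 h1).resolve_right hv

theorem IsPowerExtension.relMap_injective (hX : IsPowerExtension K ρ φ) (hirr : IsIrred H V)
    [FaithfulSMul H V] [Nontrivial H] : Function.Injective (relMap K ρ φ) := by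
  rw [injective_iff_map_eq_zero]
  rintro ⟨c, u⟩ h
  have hc := hX.eq_zero_of_relMap_eq_zero hirr h
  subst hc
  rw [Prod.mk_eq_zero]
  refine ⟨rfl, hirr.eq_zero_of_forall_smul_eq fun g => ?_⟩
  obtain ⟨x, -, rfl⟩ := hX.exists_eq 0 g
  have h1 := congrFun h x
  rw [relMap_apply] at h1
  exact (by simpa [sub_eq_zero] using h1 : u = ρ x • u).symm

/-- A lower bound for the number of generators of a power extension. -/
theorem IsPowerExtension.add_finrank_le (hX : IsPowerExtension K ρ φ) (hirr : IsIrred H V)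
    [FaithfulSMul H V] [Nontrivial H] [Finite V] {m : ℕ} {z : Fin m → X}
    (hz : Subgroup.closure (Set.range z) = ⊤) :
    n + Module.finrank K V ≤ m * Module.finrank K V := by
  -- The coordinates and the principal crossed homomorphisms span `n + dim V` dimensions, and
  -- evaluation at the generators is injective on this space.
  have := finrank_le_of_eval_injective (LinearMap.range (relMap K ρ φ)) z (by
    rintro _ ⟨a, rfl⟩ h
    refine cocycle_eq_zero_of_closure (relMap_mem_cocycles hX.cocycle a) hz ?_
    rintro _ ⟨i, rfl⟩
    exact h i)
  rwa [LinearMap.finrank_range_of_inj (hX.relMap_injective hirr), Module.finrank_prod,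
    Module.finrank_fin_fun] at this

/-- The values at elements of `Y` lying over `1` of a tuple of crossed homomorphisms. -/
def coordSubgroup {φ : Fin n → X → V} (hφ : ∀ j, φ j ∈ cocycles K ρ) (Y : Subgroup X) :
    AddSubgroup (Fin n → V) where
  carrier := {t | ∃ y ∈ Y, ρ y = 1 ∧ ∀ j, φ j y = t j}
  zero_mem' := ⟨1, Y.one_mem, map_one ρ, fun j => cocycle_one (hφ j)⟩
  add_mem' := by
    rintro s t ⟨x, hx, hx1, hxs⟩ ⟨y, hy, hy1, hyt⟩
    refine ⟨x * y, Y.mul_mem hx hy, by rw [map_mul, hx1, hy1, one_mul], fun j => ?_⟩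
    rw [hφ j, hxs, hyt, hx1, one_smul, Pi.add_apply]
  neg_mem' := by
    rintro s ⟨x, hx, hx1, hxs⟩
    refine ⟨x⁻¹, Y.inv_mem hx, by rw [map_inv, hx1, inv_one], fun j => ?_⟩
    rw [cocycle_inv (hφ j), hxs, hx1, inv_one, one_smul, Pi.neg_apply]

theorem smul_mem_coordSubgroup (hφ : ∀ j, φ j ∈ cocycles K ρ) {Y : Subgroup X}
    (hY : Y.map ρ = ⊤) (h : H) (t : Fin n → V) (ht : t ∈ coordSubgroup hφ Y) :
    h • t ∈ coordSubgroup hφ Y := by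
  obtain ⟨x, hx, hx1, hxt⟩ := ht
  obtain ⟨y, hy, rfl⟩ : h ∈ Y.map ρ := hY ▸ Subgroup.mem_top h
  refine ⟨y * x * y⁻¹, Y.mul_mem (Y.mul_mem hy hx) (Y.inv_mem hy), ?_, fun j => ?_⟩
  · rw [map_mul, map_mul, hx1, mul_one, map_inv, mul_inv_cancel]
  · rw [hφ j, hφ j, cocycle_inv (hφ j), hxt, map_mul, hx1, mul_one,
      smul_neg, smul_inv_smul, Pi.smul_apply]
    abel

/-- The part of `Y` over `1` is a proper submodule of `V^n`, so some combination of the coordinates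
vanishes on it. On `Y` that combination factors through `H`, hence is principal, and `u` absorbs it.
-/
theorem IsPowerExtension.exists_relMap_eq_zero (hX : IsPowerExtension K ρ φ)
    (hirr : IsIrred H V) (hK : IsFullEnd H V K) [FaithfulSMul H V] [Nontrivial H]
    [Finite H] [Group.IsSolvable H] [Finite V] {p : ℕ} (hp : p.Prime) (hpV : ∀ v : V, p • v = 0)
    {Y : Subgroup X} (hY : Y.map ρ = ⊤) (hne : Y ≠ ⊤) :
    ∃ (c : Fin n → K) (u : V), c ≠ 0 ∧ ∀ y ∈ Y, relMap K ρ φ (c, u) y = 0 := by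
  set T : AddSubgroup (Fin n → V) := coordSubgroup hX.cocycle Y
  have hTne : T ≠ ⊤ := by
    refine fun h => hne (eq_top_iff.2 fun x _ => ?_)
    obtain ⟨y, hy, hyx⟩ : ρ x ∈ Y.map ρ := hY ▸ Subgroup.mem_top _
    obtain ⟨t, ht, ht1, htx⟩ : (fun j => φ j (x * y⁻¹)) ∈ T := h ▸ AddSubgroup.mem_top _
    have h2 : t = x * y⁻¹ := hX.bijective.1 (Prod.ext (funext htx) (by
      change ρ t = ρ (x * y⁻¹)
      rw [ht1, map_mul, map_inv, hyx, mul_inv_cancel]))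
    have h3 : x = t * y := by rw [h2]; group
    rw [h3]
    exact Y.mul_mem ht hy
  obtain ⟨c, hc, hcT⟩ := exists_relation hirr hK T (smul_mem_coordSubgroup hX.cocycle hY) hTne
  have hf : relMap K ρ φ (c, 0) ∈ cocycles K ρ := relMap_mem_cocycles hX.cocycle _
  obtain ⟨u, hu⟩ := exists_eq_principal_on hirr hp hpV hf hY fun y hy hy1 => by
    have := hcT (fun j => φ j y) ⟨y, hy, hy1, fun _ => rfl⟩
    simpa [relMap_apply] using this
  refine ⟨c, u, hc, fun y hy => ?_⟩
  have := hu y hy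
  rw [relMap_apply] at this ⊢
  simpa [sub_eq_zero] using this

/-- The map `u ↦ (hᵢ • u - u)ᵢ`. -/
def tuplePrincipal (K : Type*) [DivisionRing K] [Module K V] [SMulCommClass H K V]
    {m : ℕ} (h : Fin m → H) : V →ₗ[K] (Fin m → V) where
  toFun u i := h i • u - u
  map_add' u v := by
    funext i
    simp only [Pi.add_apply, smul_add]
    abel
  map_smul' c u := by
    funext i
    simp only [Pi.smul_apply, RingHom.id_apply, smul_sub, smul_comm (h i) c]

@[simp] theorem tuplePrincipal_apply {m : ℕ} (h : Fin m → H) (u : V) (i : Fin m) :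
    tuplePrincipal K h u i = h i • u - u := rfl

theorem tuplePrincipal_injective (hirr : IsIrred H V) [FaithfulSMul H V] [Nontrivial H] {m : ℕ}
    {h : Fin m → H} (hh : Subgroup.closure (Set.range h) = ⊤) :
    Function.Injective (tuplePrincipal (V := V) K h) := by
  rw [injective_iff_map_eq_zero]
  intro u hu
  refine hirr.eq_zero_of_forall_smul_eq fun g => ?_
  have : Subgroup.closure (Set.range h) ≤ MulAction.stabilizer H u := by
    rw [Subgroup.closure_le]
    rintro _ ⟨i, rfl⟩
    exact sub_eq_zero.1 (congrFun hu i)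
  exact this (hh ▸ Subgroup.mem_top g)

theorem sum_smul_eq_of_relMap_eq_zero {m : ℕ} {z : Fin m → X} {w : Fin n → Fin m → V}
    {h : Fin m → H} (hzw : ∀ i j, φ j (z i) = w j i) (hzh : ∀ i, ρ (z i) = h i)
    {c : Fin n → K} {u : V} (hz : ∀ i, relMap K ρ φ (c, u) (z i) = 0) :
    ∑ j, c j • w j = tuplePrincipal K h u := by
  funext i
  have := hz i
  rw [relMap_apply, sub_eq_zero, hzh] at this
  rw [tuplePrincipal_apply, ← this, Finset.sum_apply]
  exact Finset.sum_congr rfl fun j _ => by rw [Pi.smul_apply, hzw]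

/-- A proper subgroup mapping onto `H` would satisfy a nontrivial relation, so it is enough to
exclude relations common to the generators. -/
theorem IsPowerExtension.closure_insert_eq_top (hX : IsPowerExtension K ρ φ)
    (hirr : IsIrred H V) (hK : IsFullEnd H V K) [FaithfulSMul H V] [Nontrivial H]
    [Finite H] [Group.IsSolvable H] [Finite V] {p : ℕ} (hp : p.Prime) (hpV : ∀ v : V, p • v = 0)
    {m : ℕ} {x : X} {z : Fin m → X}
    (hgen : Subgroup.closure (insert (ρ x) (Set.range fun i => ρ (z i))) = ⊤)
    (hrel : ∀ (c : Fin n → K) (u : V), (∀ i, relMap K ρ φ (c, u) (z i) = 0) →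
      relMap K ρ φ (c, u) x = 0 → c = 0) :
    Subgroup.closure (insert x (Set.range z)) = ⊤ := by
  by_contra hne
  have hmap : (Subgroup.closure (insert x (Set.range z))).map ρ = ⊤ := by
    rw [MonoidHom.map_closure, Set.image_insert_eq, ← Set.range_comp]
    exact hgen
  obtain ⟨c, u, hc, hcu⟩ := hX.exists_relMap_eq_zero hirr hK hp hpV hmap hne
  exact hc (hrel c u
    (fun i => hcu _ (Subgroup.subset_closure (Set.mem_insert_of_mem _ ⟨i, rfl⟩)))
    (hcu _ (Subgroup.subset_closure (Set.mem_insert _ _))))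

/-- Lifting generators of `H` to a power extension, when they act without common fixed points, with
a prescribed relation. -/
theorem IsPowerExtension.exists_lift (hX : IsPowerExtension K ρ φ)
    (hirr : IsIrred H V) (hK : IsFullEnd H V K) [FaithfulSMul H V] [Nontrivial H]
    [Finite H] [Group.IsSolvable H] [Finite V] {p : ℕ} (hp : p.Prime) (hpV : ∀ v : V, p • v = 0)
    {m : ℕ} {h : Fin m → H} {x : X} (hn : n + Module.finrank K V ≤ m * Module.finrank K V + 1)
    (hgen : Subgroup.closure (insert (ρ x) (Set.range h)) = ⊤)
    (hinj : Function.Injective (tuplePrincipal (V := V) K h)) {c : Fin n → K} (hc : c ≠ 0) {u : V}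
    (hx : relMap K ρ φ (c, u) x ≠ 0) :
    ∃ z : Fin m → X, (∀ i, ρ (z i) = h i) ∧ (∀ i, relMap K ρ φ (c, u) (z i) = 0) ∧
      Subgroup.closure (insert x (Set.range z)) = ⊤ := by
  obtain ⟨w, hw, huniq⟩ := exists_unique_relation_mod_range (tuplePrincipal (V := V) K h)
    (by rwa [LinearMap.finrank_range_of_inj hinj, Module.finrank_pi_fintype, Finset.sum_const,
      Finset.card_univ, Fintype.card_fin, smul_eq_mul]) hc u
  obtain ⟨z, hzw, hzh⟩ := hX.exists_tuple w h
  have hz0 : ∀ i, relMap K ρ φ (c, u) (z i) = 0 := by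
    intro i
    rw [relMap_apply, hzh, ← tuplePrincipal_apply (K := K), ← hw, Finset.sum_apply, sub_eq_zero]
    exact Finset.sum_congr rfl fun j _ => by rw [Pi.smul_apply, hzw]
  refine ⟨z, hzh, hz0, hX.closure_insert_eq_top hirr hK hp hpV (by simpa only [hzh] using hgen)
    fun c' u' hz hx' => ?_⟩
  have hrel := sum_smul_eq_of_relMap_eq_zero hzw hzh hz
  obtain ⟨k, rfl⟩ := huniq c' u' hrel
  -- Absence of common fixed vectors makes `u'` determined by `c'`. A surviving relation is thus a
  -- multiple of the prescribed one, which fails at `x`.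
  have hu' : u' = k • u := hinj (by
    rw [← hrel, map_smul, ← hw, Finset.smul_sum]
    exact Finset.sum_congr rfl fun j _ => by rw [Pi.smul_apply, smul_eq_mul, mul_smul])
  rw [hu', ← Prod.smul_mk, map_smul, Pi.smul_apply] at hx'
  rw [(smul_eq_zero.1 hx').resolve_right hx, zero_smul]

/-- In a power extension `X = V^n : H` with `n = r(m-1)+1` and `rank H ≤ m`, every element outside
a maximal subgroup generates `X` with `m` suitable elements of the maximal subgroup. -/
theorem IsPowerExtension.exists_tuple_mem (hX : IsPowerExtension K ρ φ)
    (hirr : IsIrred H V) (hK : IsFullEnd H V K) [FaithfulSMul H V] [Nontrivial H]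
    [Finite H] [Group.IsSolvable H] [Finite V] {p : ℕ} (hp : p.Prime) (hpV : ∀ v : V, p • v = 0)
    {m : ℕ} (hm : Group.rank H ≤ m) (hn0 : n ≠ 0)
    (hn : n + Module.finrank K V ≤ m * Module.finrank K V + 1)
    {M : Subgroup X} (hM : IsCoatom M) {x : X} (hx : x ∉ M) :
    ∃ z : Fin m → X, (∀ i, z i ∈ M) ∧ Subgroup.closure (insert x (Set.range z)) = ⊤ := by
  by_cases hMρ : M.map ρ = ⊤
  · obtain ⟨c, u, hc, hcM⟩ := hX.exists_relMap_eq_zero hirr hK hp hpV hMρ hM.1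
    have hco : relMap K ρ φ (c, u) ∈ cocycles K ρ := relMap_mem_cocycles hX.cocycle _
    -- By maximality `M` is exactly the zero set of its relation, so lifts satisfying the relation
    -- lie in `M`, and `x` violates it.
    have hzero : cocycleZero _ hco = M := by
      by_contra hne
      have htop := hM.2 _ (lt_of_le_of_ne (fun y hy => hcM y hy) (Ne.symm hne))
      refine hc (hX.eq_zero_of_relMap_eq_zero hirr (u := u) (funext fun y => ?_))
      exact (htop ▸ Subgroup.mem_top y : y ∈ cocycleZero _ hco)
    obtain ⟨h, hh⟩ := rank_le_iff_exists_tuple.1 hm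
    obtain ⟨z, -, hz, hcl⟩ := hX.exists_lift hirr hK hp hpV hn (x := x) (h := h)
      (top_le_iff.1 (hh ▸ Subgroup.closure_mono (Set.subset_insert _ _)))
      (tuplePrincipal_injective hirr hh) hc (u := u)
      (fun h0 => hx (hzero ▸ (mem_cocycleZero hco).2 h0))
    exact ⟨z, fun i => hzero ▸ (mem_cocycleZero hco).2 (hz i), hcl⟩
  -- Now `M` is the full preimage of a maximal subgroup of `H`, so only the images in `H` decide
  -- membership in `M`.
  · have hsurj : Function.Surjective ρ := MonoidHom.range_eq_top.1
      (by rw [MonoidHom.range_eq_map, hX.map_top])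
    have hcomap : (M.map ρ).comap ρ = M := by
      by_contra hne
      have htop := hM.2 _ (lt_of_le_of_ne (Subgroup.le_comap_map ρ M) (Ne.symm hne))
      refine hMρ ?_
      rw [← Subgroup.map_comap_eq_self_of_surjective hsurj (M.map ρ), htop, hX.map_top]
    have hMH : IsCoatom (M.map ρ) := by
      refine ⟨hMρ, fun N hN => ?_⟩
      have hlt : M < N.comap ρ := by
        rw [← hcomap]
        exact (Subgroup.comap_lt_comap_of_surjective hsurj).2 hN
      rw [← Subgroup.map_comap_eq_self_of_surjective hsurj N, hM.2 _ hlt, hX.map_top]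
    have hmem : ∀ y, y ∈ M ↔ ρ y ∈ M.map ρ := fun y => by
      rw [← Subgroup.mem_comap, hcomap]
    have hxρ : ρ x ∉ M.map ρ := fun h => hx ((hmem x).2 h)
    obtain ⟨h, hhM, hh⟩ := exists_tuple_mem_closure_insert_eq_top rfl hm hMH hxρ
    by_cases hinj : Function.Injective (tuplePrincipal (V := V) K h)
    · obtain ⟨v, hv⟩ : ∃ v : V, ρ x • v ≠ v := by
        by_contra! hfix
        refine hxρ ?_
        rw [show ρ x = 1 from FaithfulSMul.eq_of_smul_eq_smul (α := V) fun v => by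
          rw [hfix, one_smul]]
        exact one_mem _
      have hc : (fun _ => 1 : Fin n → K) ≠ 0 := fun h0 =>
        one_ne_zero (congrFun h0 ⟨0, Nat.pos_of_ne_zero hn0⟩)
      -- Any nonzero `c` would do. Since `ρ x` acts nontrivially, `u = 0` and `u = v` cannot both
      -- give a relation that holds at `x`.
      obtain ⟨u, hu⟩ : ∃ u : V, relMap K ρ φ (fun _ => 1, u) x ≠ 0 := by
        by_contra! h0
        have h1 := h0 v
        have h2 := h0 0
        simp only [relMap_apply, smul_zero, sub_zero] at h1 h2
        rw [h2, zero_sub, neg_eq_zero, sub_eq_zero] at h1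
        exact hv h1
      obtain ⟨z, hzh, -, hcl⟩ := hX.exists_lift hirr hK hp hpV hn hh hinj hc hu
      exact ⟨z, fun i => (hmem _).2 (hzh i ▸ hhM i), hcl⟩
    -- A common fixed vector lowers the rank of `tuplePrincipal` by at least one, which pays for the
    -- extra `1` in `hn`: lifts with no relation at all exist.
    · have hlt : Module.finrank K (LinearMap.range (tuplePrincipal (V := V) K h)) + 1 ≤
          Module.finrank K V := by
        have h1 := LinearMap.finrank_range_add_finrank_ker (tuplePrincipal (V := V) K h)
        have h2 : 0 < Module.finrank K (LinearMap.ker (tuplePrincipal (V := V) K h)) := by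
          rw [Nat.pos_iff_ne_zero]
          exact fun h0 => hinj (LinearMap.ker_eq_bot.1 (Submodule.finrank_eq_zero.1 h0))
        omega
      obtain ⟨w, hw⟩ := exists_independent_mod_range (n := n) (tuplePrincipal (V := V) K h) (by
        rw [Module.finrank_pi_fintype, Finset.sum_const, Finset.card_univ, Fintype.card_fin,
          smul_eq_mul]
        omega)
      obtain ⟨z, hzw, hzh⟩ := hX.exists_tuple w h
      refine ⟨z, fun i => (hmem _).2 (hzh i ▸ hhM i), hX.closure_insert_eq_top hirr hK hp hpV
        (by simpa only [hzh] using hh) fun c u hz _ => ?_⟩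
      exact hw c u (sum_smul_eq_of_relMap_eq_zero hzw hzh hz)

end PowerExtension

/-! ### Groups all of whose nontrivial elements occur in small generating sets -/

section Structure

variable {H V X K : Type*} [Group H] [AddCommGroup V] [DistribMulAction H V] [Group X]
  [DivisionRing K] [Module K V] [SMulCommClass H K V] {ρ : X →* H}

/-- Writing `x = ι (f x) * y` with `y ∈ Y` defines `f` uniquely, and the conjugation rule is the
cocycle identity. -/
theorem exists_cocycle_of_complement {ι : Multiplicative V →* X} (hι : Function.Injective ι)
    (hconj : ∀ (x : X) (v : V), x * ι (.ofAdd v) * x⁻¹ = ι (.ofAdd (ρ x • v)))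
    (hρι : ∀ v, ρ (ι v) = 1) [ι.range.Normal] {Y : Subgroup X} (hsup : Y ⊔ ι.range = ⊤)
    (hinf : Y ⊓ ι.range = ⊥) :
    ∃ f ∈ cocycles K ρ, (∀ v, f (ι (.ofAdd v)) = v) ∧ ∀ y ∈ Y, f y = 0 := by
  have hdec : ∀ x : X, ∃ v : V, (ι (.ofAdd v))⁻¹ * x ∈ Y := by
    intro x
    obtain ⟨_, ⟨v, rfl⟩, y, hy, rfl⟩ := Subgroup.mem_sup_of_normal_left.1
      ((sup_comm Y _ ▸ hsup) ▸ Subgroup.mem_top x : x ∈ ι.range ⊔ Y)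
    exact ⟨v.toAdd, by simpa using hy⟩
  choose f hf using hdec
  have huniq : ∀ x v, (ι (.ofAdd v))⁻¹ * x ∈ Y → f x = v := by
    intro x v hv
    have h1 : ι (.ofAdd (f x - v)) ∈ Y ⊓ ι.range := by
      refine ⟨?_, _, rfl⟩
      have := Y.mul_mem hv (Y.inv_mem (hf x))
      rw [ofAdd_sub, map_div, div_eq_mul_inv]
      have h2 : ι (.ofAdd (f x)) * (ι (.ofAdd v))⁻¹ = (ι (.ofAdd v))⁻¹ * ι (.ofAdd (f x)) := by
        rw [← map_inv, ← map_mul, ← map_mul, mul_comm]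
      rw [SetLike.mem_coe, h2]
      simpa [mul_assoc] using this
    rw [hinf, Subgroup.mem_bot, ← map_one ι] at h1
    exact sub_eq_zero.1 (Multiplicative.ofAdd.injective (hι h1))
  refine ⟨f, fun x y => huniq _ _ ?_, fun v => huniq _ _ ?_, fun y hy => huniq _ _ ?_⟩
  · have hρ : ρ x = ρ ((ι (.ofAdd (f x)))⁻¹ * x) := by
      rw [map_mul, map_inv, hρι, inv_one, one_mul]
    have h1 := hconj ((ι (.ofAdd (f x)))⁻¹ * x) (f y)
    rw [← hρ] at h1
    have h2 : (ι (.ofAdd (f x + ρ x • f y)))⁻¹ * (x * y) =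
        ((ι (.ofAdd (f x)))⁻¹ * x) * ((ι (.ofAdd (f y)))⁻¹ * y) := by
      rw [ofAdd_add, map_mul, ← h1]
      group
    rw [h2]
    exact Y.mul_mem (hf x) (hf y)
  · rw [inv_mul_cancel]
    exact Y.one_mem
  · simpa using hy

/-- If `X` is not generated by `m` elements, but each nontrivial element occurs in a generating
`m + 1`-tuple, the space of crossed homomorphisms to a minimal normal subgroup is large. -/
theorem lt_finrank_cocycles [Finite X] [Finite V] [Nontrivial V] {m : ℕ}
    (hrank : m < Group.rank X)
    (hgen : ∀ x : X, x ≠ 1 →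
      ∃ z : Fin m → X, Subgroup.closure (insert x (Set.range z)) = ⊤)
    {ι : Multiplicative V →* X} (hι : Function.Injective ι)
    (hconj : ∀ (x : X) (v : V), x * ι (.ofAdd v) * x⁻¹ = ι (.ofAdd (ρ x • v)))
    (hρι : ∀ v, ρ (ι v) = 1) (hA : IsAbelianMinimalNormal ι.range) :
    m * Module.finrank K V < Module.finrank K (cocycles K ρ : Submodule K (X → V)) := by
  have := hA.normal
  obtain ⟨v₀, hv₀⟩ := exists_ne (0 : V)
  obtain ⟨z, hz⟩ := hgen (ι (.ofAdd v₀)) fun h => hv₀ (by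
    rw [← map_one ι] at h
    exact Multiplicative.ofAdd.injective (hι h))
  have key : ∀ a : Fin m → V, ∃ f ∈ cocycles K ρ, (∀ v, f (ι (.ofAdd v)) = v) ∧
      ∀ i, f (z i * ι (.ofAdd (a i))) = 0 := by
    intro a
    set Y := Subgroup.closure (Set.range fun i => z i * ι (.ofAdd (a i))) with hY
    have hsup : Y ⊔ ι.range = ⊤ := by
      rw [eq_top_iff, ← hz, Subgroup.closure_le]
      rintro g (rfl | hg)
      · exact Subgroup.mem_sup_right ⟨_, rfl⟩
      · exact closure_range_mul_sup (A := ι.range) z (fun i => ⟨ι (.ofAdd (a i)), _, rfl⟩)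
          (Subgroup.subset_closure hg)
    have hne : Y ≠ ⊤ := fun h => by
      have := rank_le_iff_exists_tuple.2 ⟨_, h⟩
      omega
    obtain ⟨f, hf, hfv, hfY⟩ := exists_cocycle_of_complement (K := K) hι hconj hρι hsup
      ((hA.eq_top_or_inf_eq_bot hsup).resolve_left hne)
    exact ⟨f, hf, hfv, fun i => hfY _ (Subgroup.subset_closure ⟨i, rfl⟩)⟩
  set ev := (LinearMap.funLeft K V z).domRestrict (cocycles K ρ) with hev
  have hsurj : LinearMap.range ev = ⊤ := by
    rw [LinearMap.range_eq_top]
    intro b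
    -- With this correction, vanishing at the corrected generators says exactly that `f (z i) = b
    -- i`.
    obtain ⟨f, hf, hfv, hfz⟩ := key fun i => -((ρ (z i))⁻¹ • b i)
    refine ⟨⟨f, hf⟩, funext fun i => ?_⟩
    have := hfz i
    rw [hf, hfv, smul_neg, smul_inv_smul, ← sub_eq_add_neg, sub_eq_zero] at this
    exact this
  have hker : 0 < Module.finrank K (LinearMap.ker ev) := by
    rw [Nat.pos_iff_ne_zero]
    intro h0
    -- Without correction, `f` vanishes at every `z i` but is the identity on `V`; this gives the
    -- strict inequality.
    obtain ⟨f, hf, hfv, hfz⟩ := key 0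
    have h1 : (⟨f, hf⟩ : cocycles K ρ) ∈ LinearMap.ker ev := by
      rw [LinearMap.mem_ker]
      funext i
      have := hfz i
      rwa [Pi.zero_apply, ofAdd_zero, map_one, mul_one] at this
    rw [Submodule.finrank_eq_zero.1 h0, Submodule.mem_bot] at h1
    have h2 := congrFun (congrArg Subtype.val h1) (ι (.ofAdd v₀))
    exact hv₀ (by rw [← hfv v₀]; exact h2)
  have h := LinearMap.finrank_range_add_finrank_ker ev
  rw [hsurj, finrank_top, Module.finrank_pi_fintype, Finset.sum_const, Finset.card_univ,
    Fintype.card_fin, smul_eq_mul] at h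
  omega

/-- A large space of crossed homomorphisms has no nontrivial common zero. -/
theorem eq_one_of_forall_eq_zero [Finite V] {m : ℕ}
    (hgen : ∀ x : X, x ≠ 1 →
      ∃ z : Fin m → X, Subgroup.closure (insert x (Set.range z)) = ⊤)
    {W : Submodule K (X → V)} (hW : W ≤ cocycles K ρ)
    (hdim : m * Module.finrank K V < Module.finrank K W) {x : X} (hx : ∀ f ∈ W, f x = 0) :
    x = 1 := by
  by_contra hne
  obtain ⟨z, hz⟩ := hgen x hne
  refine (finrank_le_of_eval_injective W z fun f hf h => ?_).not_gt hdim
  refine cocycle_eq_zero_of_closure (hW hf) hz ?_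
  rintro _ (rfl | ⟨i, rfl⟩)
  exacts [hx f hf, h i]

theorem cocycle_pow {f : X → V} (hf : f ∈ cocycles K ρ) (htriv : ∀ (x : X) (v : V), ρ x • v = v)
    (x : X) (n : ℕ) : f (x ^ n) = n • f x := by
  induction n with
  | zero => rw [pow_zero, cocycle_one hf, zero_smul]
  | succ n ih => rw [pow_succ, hf, ih, htriv, succ_nsmul]

/-- The coordinates are crossed homomorphisms with independent restrictions to `ker ρ`. Joined with
the principal ones they span `m * dim V + 1` dimensions, so their only common zero is `1`, giving
injectivity. A failure of surjectivity would produce a linear relation on `ker ρ`. -/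
theorem exists_isPowerExtension [Finite X] [Finite V] {m : ℕ}
    (hirr : IsIrred H V) (hK : IsFullEnd H V K) [FaithfulSMul H V] [Nontrivial H]
    [Finite H] [Group.IsSolvable H] {p : ℕ} (hp : p.Prime) (hpV : ∀ v : V, p • v = 0)
    (hρ : Function.Surjective ρ)
    (hgen : ∀ x : X, x ≠ 1 →
      ∃ z : Fin m → X, Subgroup.closure (insert x (Set.range z)) = ⊤)
    (hdim : m * Module.finrank K V < Module.finrank K (cocycles K ρ : Submodule K (X → V)))
    {n : ℕ} (hn : n + Module.finrank K V = m * Module.finrank K V + 1) :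
    ∃ φ : Fin n → X → V, IsPowerExtension K ρ φ := by
  have hmap : (⊤ : Subgroup X).map ρ = ⊤ := by
    rw [← MonoidHom.range_eq_map, MonoidHom.range_eq_top.2 hρ]
  set res := (LinearMap.funLeft K V (Subtype.val : ρ.ker → X)).domRestrict (cocycles K ρ) with hres
  -- A crossed homomorphism trivial on `ker ρ` comes from `H`, where it is principal.
  have hker : Module.finrank K (LinearMap.ker res) ≤ Module.finrank K V := by
    rw [LinearEquiv.finrank_eq (Submodule.equivSubtypeMap _ (LinearMap.ker res))]
    refine (Submodule.finrank_mono (t := LinearMap.range (principal V K ρ)) ?_).trans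
      (LinearMap.finrank_range_le _)
    rintro _ ⟨f, hf, rfl⟩
    obtain ⟨u, hu⟩ := exists_eq_principal_on hirr hp hpV f.2 hmap fun y _ hy =>
      congrFun (LinearMap.mem_ker.1 hf) ⟨y, hy⟩
    exact ⟨u, funext fun x => (hu x (Subgroup.mem_top x)).symm⟩
  have hrange : n ≤ Module.finrank K (LinearMap.range res) := by
    have := LinearMap.finrank_range_add_finrank_ker res
    omega
  obtain ⟨g, hg⟩ := exists_linearIndependent_of_le_finrank hrange
  choose φ hφ using fun j => (g j).2
  have hindep : ∀ c : Fin n → K, (∀ x, ρ x = 1 → ∑ j, c j • (φ j : X → V) x = 0) → c = 0 := by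
    intro c hc
    refine funext (Fintype.linearIndependent_iff.1 hg c (Subtype.ext (funext fun x => ?_)))
    have := hc x x.2
    rw [Submodule.coe_sum, Finset.sum_apply, Submodule.coe_zero, Pi.zero_apply, ← this]
    refine Finset.sum_congr rfl fun j _ => ?_
    rw [Submodule.coe_smul, Pi.smul_apply, ← hφ j]
    rfl
  have hmem : ∀ j, (φ j : X → V) ∈ cocycles K ρ := fun j => (φ j).2
  refine ⟨fun j => φ j, hmem, ?_, ?_⟩
  · have hinj : Function.Injective (relMap K ρ fun j => (φ j : X → V)) := by
      rw [injective_iff_map_eq_zero]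
      rintro ⟨c, u⟩ h
      have hc : c = 0 := hindep c fun x hx => by
        have := congrFun h x
        simpa [relMap_apply, hx] using this
      subst hc
      rw [Prod.mk_eq_zero]
      refine ⟨rfl, hirr.eq_zero_of_forall_smul_eq fun g => ?_⟩
      obtain ⟨x, rfl⟩ := hρ g
      have h1 := congrFun h x
      rw [relMap_apply] at h1
      exact (by simpa [sub_eq_zero] using h1 : u = ρ x • u).symm
    have hlt : m * Module.finrank K V <
        Module.finrank K (LinearMap.range (relMap K ρ fun j => (φ j : X → V))) := by
      rw [LinearMap.finrank_range_of_inj hinj, Module.finrank_prod, Module.finrank_fin_fun]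
      omega
    intro x y hxy
    have h1 : ρ x = ρ y := congrArg Prod.snd hxy
    have h2 : ∀ j, (φ j : X → V) x = (φ j : X → V) y := fun j =>
      congrFun (congrArg Prod.fst hxy) j
    have h3 : ρ (x * y⁻¹) = 1 := by rw [map_mul, map_inv, h1, mul_inv_cancel]
    rw [← mul_inv_eq_one]
    refine eq_one_of_forall_eq_zero (K := K) (ρ := ρ) (V := V) hgen
      (W := LinearMap.range (relMap K ρ fun j => (φ j : X → V))) ?_ hlt ?_
    · rintro _ ⟨a, rfl⟩
      exact relMap_mem_cocycles hmem a
    · rintro _ ⟨⟨c, u⟩, rfl⟩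
      rw [relMap_apply, h3, one_smul, sub_self, sub_zero]
      refine Finset.sum_eq_zero fun j _ => ?_
      rw [hmem j, cocycle_inv (hmem j), h2, h1, smul_neg, smul_inv_smul, add_neg_cancel, smul_zero]
  · rintro ⟨w, h⟩
    have htop : coordSubgroup hmem ⊤ = ⊤ := by
      by_contra hne
      obtain ⟨c, hc, hcT⟩ := exists_relation hirr hK _ (smul_mem_coordSubgroup hmem hmap) hne
      exact hc (hindep c fun x hx => hcT (fun j => (φ j : X → V) x)
        ⟨x, Subgroup.mem_top x, hx, fun _ => rfl⟩)
    obtain ⟨y, rfl⟩ := hρ h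
    obtain ⟨t, -, ht1, ht⟩ : (fun j => w j - (φ j : X → V) y) ∈ coordSubgroup hmem ⊤ :=
      htop ▸ AddSubgroup.mem_top _
    refine ⟨t * y, Prod.ext (funext fun j => ?_) ?_⟩
    · change (φ j : X → V) (t * y) = w j
      rw [hmem j, show (φ j : X → V) t = _ from ht j, ht1, one_smul, sub_add_cancel]
    · change ρ (t * y) = ρ y
      rw [map_mul, ht1, one_mul]

end Structure

/-! ### Irreducible linear groups over prime fields -/

section LinearGroup

variable {p : ℕ} [Fact p.Prime] {V : Type*} [AddCommGroup V] [Module (ZMod p) V]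
  (H : Subgroup (V ≃ₗ[ZMod p] V))

theorem isIrreducible_natRep_iff : (natRep H).IsIrreducible ↔ IsIrred H V := by
  constructor
  · intro h
    have hbt : (⊥ : Subrepresentation (natRep H)) ≠ ⊤ := bot_ne_top
    refine ⟨?_, fun W hW => ?_⟩
    · by_contra hV
      rw [not_nontrivial_iff_subsingleton] at hV
      exact hbt (Subrepresentation.toSubmodule_injective (Subsingleton.elim _ _))
    · let S : Subrepresentation (natRep H) :=
        ⟨AddSubgroup.toZModSubmodule p W, fun g v hv => hW g v hv⟩
      rcases eq_bot_or_eq_top S with hS | hS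
      · left
        rw [AddSubgroup.eq_bot_iff_forall]
        intro v hv
        have : v ∈ S.toSubmodule := hv
        rw [hS] at this
        exact this
      · right
        rw [eq_top_iff]
        intro v _
        have : v ∈ S.toSubmodule := by
          rw [hS]
          trivial
        exact this
  · intro h
    have := h.nontrivial
    refine { exists_pair_ne := ⟨⊥, ⊤, fun hbt => ?_⟩, eq_bot_or_eq_top := fun S => ?_ }
    · have : (⊥ : Submodule (ZMod p) V) = ⊤ := congrArg Subrepresentation.toSubmodule hbt
      exact bot_ne_top this
    · rcases h.eq_bot_or_eq_top S.toSubmodule.toAddSubgroup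
        (fun g w hw => S.apply_mem_toSubmodule g hw) with hS | hS
      · left
        refine Subrepresentation.toSubmodule_injective ?_
        exact Submodule.toAddSubgroup_injective hS
      · right
        refine Subrepresentation.toSubmodule_injective ?_
        exact Submodule.toAddSubgroup_injective hS

theorem endH_apply_comm (c : endH H) (h : H) (v : V) : c • h • v = h • c • v := by
  have := Subalgebra.mem_centralizer_iff (ZMod p) |>.1 c.2 _ ⟨h, rfl⟩
  exact (LinearMap.congr_fun this v).symm

instance smulCommClass_endH : SMulCommClass H (endH H) V :=
  ⟨fun h c v => (endH_apply_comm H c h v).symm⟩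

theorem isFullEnd_endH : IsFullEnd H V (endH H) := by
  intro f hf
  refine ⟨⟨f.toZModLinearMap p, ?_⟩, fun v => rfl⟩
  rw [Subalgebra.mem_centralizer_iff]
  rintro _ ⟨h, rfl⟩
  exact LinearMap.ext fun v => (hf h v).symm

variable {H}

/-- Schur's lemma: the commuting algebra of an irreducible group is a division ring. -/
noncomputable abbrev divisionRingEndH [Finite V] (hirr : IsIrred H V) : DivisionRing (endH H) :=
  have := hirr.nontrivial
  have : Nontrivial (endH H) := inferInstance
  DivisionRing.ofIsUnitOrEqZero fun c => by
    let f : V →+ V := (c : Module.End (ZMod p) V).toAddMonoidHom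
    have hf : ∀ (h : H) (v : V), f (h • v) = h • f v := fun h v => endH_apply_comm H c h v
    rcases hirr.eq_bot_or_eq_top f.ker (fun h w hw => by
      rw [AddMonoidHom.mem_ker] at hw ⊢
      rw [hf, hw, smul_zero]) with h | h
    · left
      have hbij : Function.Bijective f :=
        Finite.injective_iff_bijective.1 ((AddMonoidHom.ker_eq_bot_iff f).1 h)
      let e : V ≃+ V := AddEquiv.ofBijective f hbij
      have he : ∀ v, f (e.symm v) = v := fun v => e.apply_symm_apply v
      have he' : ∀ v, e.symm (f v) = v := fun v => e.symm_apply_apply v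
      obtain ⟨b, hb⟩ := isFullEnd_endH H e.symm.toAddMonoidHom fun h v => by
        change e.symm (h • v) = h • e.symm v
        rw [← he' (h • e.symm v), hf, he]
      have hcb : c * b = 1 := Subtype.ext (LinearMap.ext fun v => by
        change f (b • v) = v
        rw [← hb]
        exact he v)
      have hbc : b * c = 1 := Subtype.ext (LinearMap.ext fun v => by
        change b • (f v) = v
        rw [← hb]
        exact he' v)
      exact ⟨⟨c, b, hcb, hbc⟩, rfl⟩
    · right
      refine Subtype.ext (LinearMap.ext fun v => ?_)
      exact (h ▸ AddSubgroup.mem_top v : v ∈ f.ker)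

theorem isPowerExtension_powSemidirect [Finite V] (hirr : IsIrred H V) (n : ℕ) :
    letI := divisionRingEndH hirr
    IsPowerExtension (endH H) (SemidirectProduct.rightHom : PowSemidirect H n →* H)
      (fun j x => x.left.toAdd j) := by
  let _ := divisionRingEndH hirr
  refine ⟨fun j x y => rfl, fun x y h => ?_, fun a => ?_⟩
  · exact SemidirectProduct.ext (congrArg Prod.fst h) (congrArg Prod.snd h)
  · exact ⟨⟨.ofAdd a.1, a.2⟩, rfl⟩

theorem IsPowerExtension.nonempty_mulEquiv [Finite V] {X : Type*} [Group X] (hirr : IsIrred H V)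
    {ρ : X →* H} {n : ℕ} {φ : Fin n → X → V} :
    letI := divisionRingEndH hirr
    IsPowerExtension (endH H) ρ φ → Nonempty (X ≃* PowSemidirect H n) := by
  let _ := divisionRingEndH hirr
  intro hX
  let F : X →* PowSemidirect H n :=
    MonoidHom.mk' (fun x => ⟨.ofAdd fun j => φ j x, ρ x⟩) fun x y => by
      refine SemidirectProduct.ext ?_ (map_mul ρ x y)
      exact congrArg Multiplicative.ofAdd (funext fun j => hX.cocycle j x y)
  refine ⟨MulEquiv.ofBijective F ⟨fun x y h => hX.bijective.1 ?_, fun a => ?_⟩⟩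
  · exact Prod.ext (congrArg SemidirectProduct.left h) (congrArg SemidirectProduct.right h)
  · obtain ⟨x, hx⟩ := hX.bijective.2 (a.left.toAdd, a.right)
    exact ⟨x, SemidirectProduct.ext (congrArg Prod.fst hx) (congrArg Prod.snd hx)⟩

end LinearGroup

/-- The conjugation action on an elementary abelian normal subgroup, in coordinates. -/
theorem exists_linear_model_of_module {X : Type*} [Group X] {p : ℕ} [Fact p.Prime]
    {E : Type*} [AddCommGroup E] [Module (ZMod p) E] [Finite E] (A : Subgroup X) [A.Normal]
    (j : E ≃+ Additive A) :
    ∃ (N : ℕ) (ρ : X →* ((Fin N → ZMod p) ≃ₗ[ZMod p] (Fin N → ZMod p)))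
      (ι : Multiplicative (Fin N → ZMod p) →* X), Function.Injective ι ∧ ι.range = A ∧
      ∀ (x : X) (v : Fin N → ZMod p), x * ι (.ofAdd v) * x⁻¹ = ι (.ofAdd (ρ x v)) := by
  let b : E ≃ₗ[ZMod p] (Fin (Module.finrank (ZMod p) E) → ZMod p) :=
    (Module.finBasis (ZMod p) E).equivFun
  let e : Additive A ≃+ (Fin (Module.finrank (ZMod p) E) → ZMod p) := j.symm.trans b.toAddEquiv
  let ρ : X →* ((Fin (Module.finrank (ZMod p) E) → ZMod p) ≃ₗ[ZMod p]
      (Fin (Module.finrank (ZMod p) E) → ZMod p)) := MonoidHom.mk' (fun x =>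
    AddEquiv.toLinearEquiv ((e.symm.trans
      (MulEquiv.toAdditive (MulAut.conjNormal x : A ≃* A))).trans e)
      fun c v => ZMod.map_smul _ c v) fun x y => by
      refine LinearEquiv.ext fun v => ?_
      change e (.ofMul (MulAut.conjNormal (x * y) (e.symm v).toMul)) =
        e (.ofMul (MulAut.conjNormal x (e.symm (e (.ofMul
          (MulAut.conjNormal y (e.symm v).toMul)))).toMul))
      rw [e.symm_apply_apply, map_mul]
      rfl
  let ι : Multiplicative (Fin (Module.finrank (ZMod p) E) → ZMod p) →* X :=
    MonoidHom.mk' (fun v => ((e.symm v.toAdd).toMul : X)) fun v w => by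
      rw [toAdd_mul, map_add]
      rfl
  refine ⟨_, ρ, ι, ?_, ?_, fun x v => ?_⟩
  · exact Subtype.val_injective.comp (Additive.toMul.injective.comp
      (e.symm.injective.comp Multiplicative.toAdd.injective))
  · ext a
    constructor
    · rintro ⟨v, rfl⟩
      exact Subtype.property _
    · intro ha
      refine ⟨.ofAdd (e (.ofMul ⟨a, ha⟩)), ?_⟩
      change ((e.symm (e (.ofMul ⟨a, ha⟩))).toMul : X) = a
      rw [e.symm_apply_apply]
      rfl
  · change x * ((e.symm v).toMul : X) * x⁻¹ = ((e.symm (e (.ofMul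
      (MulAut.conjNormal x (e.symm v).toMul)))).toMul : X)
    rw [e.symm_apply_apply]
    exact (MulAut.conjNormal_apply x _).symm

theorem exists_linear_model {X : Type*} [Group X] [Finite X] {A : Subgroup X} [A.Normal]
    (hcomm : ∀ a ∈ A, ∀ b ∈ A, a * b = b * a) {p : ℕ} [Fact p.Prime] (hp : ∀ a ∈ A, a ^ p = 1) :
    ∃ (N : ℕ) (ρ : X →* ((Fin N → ZMod p) ≃ₗ[ZMod p] (Fin N → ZMod p)))
      (ι : Multiplicative (Fin N → ZMod p) →* X), Function.Injective ι ∧ ι.range = A ∧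
      ∀ (x : X) (v : Fin N → ZMod p), x * ι (.ofAdd v) * x⁻¹ = ι (.ofAdd (ρ x v)) := by
  let _ : CommGroup A :=
    { (inferInstance : Group A) with mul_comm := fun a b => Subtype.ext (hcomm a a.2 b b.2) }
  have hsmul : ∀ a : Additive A, p • a = 0 := fun a =>
    Additive.toMul.injective (Subtype.ext (hp a.toMul a.toMul.2))
  exact @exists_linear_model_of_module X _ p _ (Additive A) _ (AddCommGroup.zmodModule hsmul) _ A _
    (AddEquiv.refl _)

/-- A stable additive subgroup of `V` corresponds under `ι` to a normal subgroup of `X` inside the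
minimal one. -/
theorem isIrred_range {X : Type*} [Group X] {p : ℕ} {V : Type*} [AddCommGroup V]
    [Module (ZMod p) V] [Nontrivial V] {ρ : X →* (V ≃ₗ[ZMod p] V)} {ι : Multiplicative V →* X}
    (hι : Function.Injective ι)
    (hconj : ∀ (x : X) (v : V), x * ι (.ofAdd v) * x⁻¹ = ι (.ofAdd (ρ x v)))
    (hA : IsAbelianMinimalNormal ι.range) : IsIrred ρ.range V := by
  refine ⟨inferInstance, fun W hW => ?_⟩
  have hN : ((AddSubgroup.toSubgroup W).map ι).Normal := by
    refine ⟨?_⟩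
    rintro _ ⟨w, hw, rfl⟩ x
    exact ⟨.ofAdd (ρ x w.toAdd), hW ⟨ρ x, x, rfl⟩ _ hw, (hconj x w.toAdd).symm⟩
  rcases hA.minimal _ hN (Subgroup.map_le_range _ _) with h | h
  · left
    rw [AddSubgroup.eq_bot_iff_forall]
    intro w hw
    have h1 : ι (.ofAdd w) ∈ (AddSubgroup.toSubgroup W).map ι := ⟨_, hw, rfl⟩
    rw [h, Subgroup.mem_bot, ← map_one ι] at h1
    exact Multiplicative.ofAdd.injective (hι h1)
  · right
    rw [eq_top_iff]
    intro v _
    obtain ⟨w, hw, hwv⟩ : ι (.ofAdd v) ∈ (AddSubgroup.toSubgroup W).map ι := h ▸ ⟨_, rfl⟩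
    obtain rfl : w = .ofAdd v := hι hwv
    exact hw

/-- The structure of soluble groups which are not generated by `m` elements, but in which every
nontrivial element occurs in a generating `m + 1`-tuple. -/
theorem isPGroup_or_nonempty_mulEquiv {X : Type*} [Group X] [Finite X] [Nontrivial X]
    [Group.IsSolvable X] {m : ℕ} (hrank : m < Group.rank X)
    (hgen : ∀ x : X, x ≠ 1 →
      ∃ z : Fin m → X, Subgroup.closure (insert x (Set.range z)) = ⊤) :
    (∃ p : ℕ, p.Prime ∧ IsPGroup p X) ∨
      ∃ (p : ℕ) (_ : Fact p.Prime) (N : ℕ)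
        (H : Subgroup ((Fin N → ZMod p) ≃ₗ[ZMod p] (Fin N → ZMod p))),
        H ≠ ⊥ ∧ Group.IsSolvable H ∧ (natRep H).IsIrreducible ∧ Group.rank H < m + 1 ∧
          Nonempty (X ≃* PowSemidirect H
            (Module.finrank (endH H) (Fin N → ZMod p) * (m + 1 - 2) + 1)) := by
  obtain ⟨A, hA⟩ := exists_isAbelianMinimalNormal X
  obtain ⟨p, hp, hAp⟩ := hA.exists_prime_pow_eq_one
  have := Fact.mk hp
  have := hA.normal
  obtain ⟨N, ρ, ι, hι, rfl, hconj⟩ := exists_linear_model hA.comm hAp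
  have hNV : Nontrivial (Fin N → ZMod p) := by
    by_contra hV
    rw [not_nontrivial_iff_subsingleton] at hV
    refine hA.ne_bot ((Subgroup.eq_bot_iff_forall _).2 ?_)
    rintro _ ⟨v, rfl⟩
    rw [show v = 1 from Multiplicative.toAdd.injective (Subsingleton.elim _ _), map_one]
  have hirr : IsIrred ρ.range (Fin N → ZMod p) := isIrred_range hι hconj hA
  let _ := divisionRingEndH hirr
  have hpV : ∀ v : Fin N → ZMod p, p • v = 0 := fun v => by
    funext i
    simp
  have hρι : ∀ v, ρ (ι v) = 1 := by
    intro v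
    refine LinearEquiv.ext fun w => ?_
    have h := hconj (ι v) w
    rw [hA.comm _ ⟨v, rfl⟩ _ ⟨.ofAdd w, rfl⟩, mul_inv_cancel_right] at h
    exact (Multiplicative.ofAdd.injective (hι h)).symm
  have hdim := lt_finrank_cocycles (K := endH ρ.range) (ρ := ρ.rangeRestrict) hrank hgen hι hconj
    (fun v => Subtype.ext (hρι v)) hA
  by_cases hbot : ρ.range = ⊥
  · left
    refine ⟨p, hp, fun x => ⟨1, ?_⟩⟩
    rw [pow_one]
    -- With trivial action, crossed homomorphisms are homomorphisms to a group of exponent `p`, so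
    -- all of them kill `x ^ p`.
    refine eq_one_of_forall_eq_zero hgen le_rfl hdim fun f hf => ?_
    rw [cocycle_pow hf (fun x v => ?_), hpV]
    have h1 : ρ x ∈ ρ.range := ⟨x, rfl⟩
    rw [hbot, Subgroup.mem_bot] at h1
    change ρ x v = v
    rw [h1]
    rfl
  · right
    have hnt : Nontrivial ρ.range := (Subgroup.nontrivial_iff_ne_bot _).2 hbot
    have hsol : Group.IsSolvable ρ.range := Group.isSolvable_of_surjective ρ.rangeRestrict_surjective
    -- The generator taken in the abelian subgroup `ι.range` acts trivially, so the other `m`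
    -- generate the image.
    have hHrank : Group.rank ρ.range ≤ m := by
      obtain ⟨v₀, hv₀⟩ := exists_ne (0 : Fin N → ZMod p)
      obtain ⟨z, hz⟩ := hgen (ι (.ofAdd v₀)) fun h => hv₀ (by
        rw [← map_one ι] at h
        exact Multiplicative.ofAdd.injective (hι h))
      refine rank_le_iff_exists_tuple.2 ⟨fun i => ρ.rangeRestrict (z i), ?_⟩
      have h1 := congrArg (Subgroup.map ρ.rangeRestrict) hz
      rw [MonoidHom.map_closure, Set.image_insert_eq, ← Set.range_comp,
        show ρ.rangeRestrict (ι (.ofAdd v₀)) = 1 from Subtype.ext (hρι _),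
        Subgroup.closure_insert_one, ← MonoidHom.range_eq_map,
        MonoidHom.range_eq_top.2 ρ.rangeRestrict_surjective] at h1
      exact h1
    -- This keeps the subtraction in `m + 1 - 2` from truncating.
    have hm : 1 ≤ m := (Group.rank_pos ρ.range).trans_le hHrank
    obtain ⟨φ, hφ⟩ := exists_isPowerExtension hirr (isFullEnd_endH ρ.range) hp hpV
      ρ.rangeRestrict_surjective hgen hdim
      (n := Module.finrank (endH ρ.range) (Fin N → ZMod p) * (m + 1 - 2) + 1) (by
        obtain ⟨k, rfl⟩ : ∃ k, m = k + 1 := ⟨m - 1, by omega⟩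
        rw [show k + 1 + 1 - 2 = k by omega]
        ring)
    exact ⟨p, inferInstance, N, ρ.range, hbot, hsol, (isIrreducible_natRep_iff _).2 hirr,
      Nat.lt_succ_of_le hHrank, hφ.nonempty_mulEquiv hirr⟩

/-! ### Finite `p`-groups, Frattini quotients and the values of `psi` -/

/-- A Sylow `p`-subgroup together with the Frattini subgroup has index both a divisor of a power of
`p` and prime to `p`; the Frattini subgroup can then be dropped. -/
theorem isPGroup_of_quotient_frattini {G : Type*} [Group G] [Finite G] {p : ℕ} [Fact p.Prime]
    (h : IsPGroup p (G ⧸ frattini G)) : IsPGroup p G := by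
  let P : Sylow p G := default
  have htop : (P : Subgroup G) ⊔ frattini G = ⊤ := by
    rw [← Subgroup.index_eq_one]
    obtain ⟨k, hk⟩ := IsPGroup.iff_card.1 h
    have h1 : ((P : Subgroup G) ⊔ frattini G).index ∣ p ^ k := by
      rw [← hk]
      exact Subgroup.index_dvd_of_le le_sup_right
    have h2 : ((P : Subgroup G) ⊔ frattini G).index ∣ (P : Subgroup G).index :=
      Subgroup.index_dvd_of_le le_sup_left
    have h3 : Nat.Coprime (p ^ k) (P : Subgroup G).index :=
      ((Nat.Prime.coprime_iff_not_dvd Fact.out).2 P.not_dvd_index).pow_left k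
    exact Nat.eq_one_of_dvd_coprimes h3 h1 h2
  have hP : (P : Subgroup G) = ⊤ := frattini_nongenerating htop
  have := P.isPGroup'
  rw [hP] at this
  exact this.of_equiv Subgroup.topEquiv

/-- Subgroups are subspaces over `ZMod p`, and a proper subspace has smaller dimension. -/
theorem rank_lt_rank_of_module {p : ℕ} [Fact p.Prime] {Q : Type*} [CommGroup Q] [Finite Q]
    [Module (ZMod p) (Additive Q)] {M : Subgroup Q} (hM : M ≠ ⊤) :
    Group.rank M < Group.rank Q := by
  let W : Submodule (ZMod p) (Additive Q) := AddSubgroup.toZModSubmodule p M.toAddSubgroup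
  have hW : W ≠ ⊤ := fun h => hM (eq_top_iff.2 fun x _ => by
    have : Additive.ofMul x ∈ W := by
      rw [h]
      trivial
    exact this)
  have hlt : Module.finrank (ZMod p) W < Module.finrank (ZMod p) (Additive Q) :=
    Submodule.finrank_lt (lt_top_iff_ne_top.2 hW).ne
  have hQ : Module.finrank (ZMod p) (Additive Q) ≤ Group.rank Q := by
    obtain ⟨z, hz⟩ := rank_le_iff_exists_tuple.1 (le_refl (Group.rank Q))
    let y : Fin (Group.rank Q) → Additive Q := fun i => Additive.ofMul (z i)
    have hspan : Submodule.span (ZMod p) (Set.range y) = ⊤ := by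
      rw [eq_top_iff]
      intro a _
      have h1 : Subgroup.closure (Set.range z) ≤ AddSubgroup.toSubgroup'
          (Submodule.span (ZMod p) (Set.range y)).toAddSubgroup := by
        rw [Subgroup.closure_le]
        rintro _ ⟨i, rfl⟩
        have : y i ∈ Submodule.span (ZMod p) (Set.range y) := Submodule.subset_span ⟨i, rfl⟩
        exact this
      exact h1 (hz ▸ Subgroup.mem_top a.toMul)
    have := finrank_range_le_card (R := ZMod p) y
    rwa [Set.finrank, hspan, finrank_top, Fintype.card_fin] at this
  let b := Module.finBasis (ZMod p) W
  let w : Fin (Module.finrank (ZMod p) W) → M := fun i => ⟨(b i : Additive Q).toMul, (b i).2⟩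
  refine lt_of_le_of_lt (rank_le_iff_exists_tuple.2 ⟨w, ?_⟩) (hlt.trans_le hQ)
  rw [eq_top_iff]
  intro a _
  let g : W →+ Additive M :=
    AddMonoidHom.mk' (fun w => Additive.ofMul ⟨(w : Additive Q).toMul, w.2⟩) fun _ _ => rfl
  let C : AddSubgroup W := (Subgroup.toAddSubgroup (Subgroup.closure (Set.range w))).comap g
  have hle : Submodule.span (ZMod p) (Set.range b) ≤ AddSubgroup.toZModSubmodule p C := by
    rw [Submodule.span_le]
    rintro _ ⟨i, rfl⟩
    have : w i ∈ Subgroup.closure (Set.range w) := Subgroup.subset_closure ⟨i, rfl⟩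
    exact this
  rw [b.span_eq] at hle
  exact hle (x := ⟨Additive.ofMul a.1, a.2⟩) trivial

/-- In an elementary abelian group every element outside a maximal subgroup generates the group
together with few elements of the maximal subgroup. -/
theorem exists_tuple_mem_of_elementary {Q : Type*} [Group Q] [Finite Q]
    (hcomm : ∀ a b : Q, a * b = b * a) {p : ℕ} [Fact p.Prime] (hp : ∀ a : Q, a ^ p = 1)
    {M : Subgroup Q} (hM : IsCoatom M) {x : Q} (hx : x ∉ M) :
    ∃ z : Fin (Group.rank Q - 1) → Q, (∀ i, z i ∈ M) ∧
      Subgroup.closure (insert x (Set.range z)) = ⊤ := by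
  have hrank : Group.rank M < Group.rank Q := by
    let _ : CommGroup Q := { (inferInstance : Group Q) with mul_comm := hcomm }
    have hsmul : ∀ a : Additive Q, p • a = 0 := fun a => Additive.toMul.injective (hp a.toMul)
    exact @rank_lt_rank_of_module p _ Q _ _ (AddCommGroup.zmodModule hsmul) M hM.1
  obtain ⟨z, hz⟩ := rank_le_iff_exists_tuple.1 (Nat.le_sub_one_of_lt hrank)
  refine ⟨fun i => z i, fun i => (z i).2, hM.2 _ (lt_of_le_of_ne ?_ fun h => hx ?_)⟩
  · have h1 := congrArg (Subgroup.map M.subtype) hz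
    rw [MonoidHom.map_closure, ← MonoidHom.range_eq_map, Subgroup.range_subtype,
      ← Set.range_comp] at h1
    exact h1.ge.trans (Subgroup.closure_mono (Set.subset_insert _ _))
  · rw [h]
    exact Subgroup.subset_closure (Set.mem_insert _ _)

theorem card_quotient_of_isCoatom {G : Type*} [Group G] [Finite G] {p : ℕ} [Fact p.Prime]
    (h : IsPGroup p G) {M : Subgroup G} (hM : IsCoatom M) [M.Normal] :
    Nat.card (G ⧸ M) = p := by
  have hQ : IsPGroup p (G ⧸ M) := h.to_quotient M
  have hnt : Nontrivial (G ⧸ M) := QuotientGroup.nontrivial_iff.2 hM.1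
  obtain ⟨k, hk, hcard⟩ := hQ.nontrivial_iff_card.1 hnt
  obtain ⟨a, ha⟩ := exists_prime_orderOf_dvd_card' (G := G ⧸ M) p
    (hcard ▸ dvd_pow_self p hk.ne')
  have htop : Subgroup.zpowers a = ⊤ := by
    obtain ⟨g, rfl⟩ := QuotientGroup.mk'_surjective M a
    have hf := QuotientGroup.mk'_surjective M
    rw [← Subgroup.map_comap_eq_self_of_surjective hf (Subgroup.zpowers _),
      hM.2 ((Subgroup.zpowers (QuotientGroup.mk' M g)).comap (QuotientGroup.mk' M)) ?_,
      ← MonoidHom.range_eq_map, MonoidHom.range_eq_top.2 hf]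
    refine lt_of_le_of_ne (fun y hy => ?_) fun he => ?_
    · rw [Subgroup.mem_comap, show QuotientGroup.mk' M y = 1 from
        (QuotientGroup.eq_one_iff y).2 hy]
      exact one_mem _
    · have hg : g ∈ M := by
        rw [he]
        exact Subgroup.mem_zpowers _
      rw [show QuotientGroup.mk' M g = 1 from (QuotientGroup.eq_one_iff g).2 hg,
        orderOf_one] at ha
      exact (Fact.out : p.Prime).one_lt.ne ha
  rw [← ha, ← Nat.card_zpowers, htop, Subgroup.card_top]

/-- Maximal subgroups of a nilpotent group are normal, here of index `p`, so each contains all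
commutators and `p`-th powers. -/
theorem quotient_frattini_elementary {G : Type*} [Group G] [Finite G] {p : ℕ} [Fact p.Prime]
    (h : IsPGroup p G) : (∀ a b : G ⧸ frattini G, a * b = b * a) ∧
      ∀ a : G ⧸ frattini G, a ^ p = 1 := by
  have hnormal : ∀ M : Subgroup G, IsCoatom M → M.Normal :=
    (Group.isNilpotent_of_finite_tfae (G := G)).out 0 2 |>.1 h.isNilpotent
  have key : ∀ M : Subgroup G, IsCoatom M → ∃ _ : M.Normal,
      (∀ a b : G ⧸ M, a * b = b * a) ∧ ∀ a : G ⧸ M, a ^ p = 1 := by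
    intro M hM
    have hMn := hnormal M hM
    have hcard : Nat.card (G ⧸ M) = p := card_quotient_of_isCoatom h hM
    refine ⟨hMn, ?_, fun a => ?_⟩
    · have := isCyclic_of_prime_card hcard
      have := IsCyclic.isMulCommutative (α := G ⧸ M)
      exact mul_comm'
    · rw [← hcard]
      exact pow_card_eq_one'
  constructor
  · intro a b
    obtain ⟨a, rfl⟩ := QuotientGroup.mk_surjective a
    obtain ⟨b, rfl⟩ := QuotientGroup.mk_surjective b
    refine (QuotientGroup.eq (s := frattini G)).2 (mem_frattini_iff.2 fun M hM => ?_)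
    obtain ⟨hMn, hc, -⟩ := key M hM
    exact QuotientGroup.eq.1 (hc a b)
  · intro a
    obtain ⟨a, rfl⟩ := QuotientGroup.mk_surjective a
    refine (QuotientGroup.eq_one_iff (N := frattini G) (a ^ p)).2
      (mem_frattini_iff.2 fun M hM => ?_)
    obtain ⟨hMn, -, hp⟩ := key M hM
    exact (QuotientGroup.eq_one_iff (N := M) (a ^ p)).1 (hp a)

theorem psi_eq_rank_of_isPGroup {G : Type*} [Group G] [Finite G] [Nontrivial G] {p : ℕ}
    [Fact p.Prime] (h : IsPGroup p G) : psi G = Group.rank G := by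
  refine le_antisymm ?_ rank_le_psi
  have hf := QuotientGroup.mk'_surjective (frattini G)
  have hQ : Nontrivial (G ⧸ frattini G) := QuotientGroup.nontrivial_iff.2 frattini_ne_top
  refine le_trans (psi_le_of_surjective (QuotientGroup.mk' (frattini G)) hf
    (QuotientGroup.ker_mk' _).le (Group.rank_pos (G ⧸ frattini G)) fun x y hxy => ?_)
    (Group.rank_le_of_surjective _ hf)
  obtain ⟨h1, h2⟩ := quotient_frattini_elementary h
  exact equivM_of_equivMr (fun M hM x hx => exists_tuple_mem_of_elementary h1 h2 hM hx) hxy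

/-- The chain `rank G ≤ psi G ≤ d ≤ rank G` closes up: the second bound is `exists_tuple_mem` with
`m = d - 1`, and the third holds since `d - 1` generators would violate `add_finrank_le` by exactly
one dimension. -/
theorem psi_eq_rank_of_mulEquiv {G : Type*} [Group G] [Finite G] [Nontrivial G] {p : ℕ}
    [Fact p.Prime] {V : Type*} [AddCommGroup V] [Module (ZMod p) V] [Finite V]
    {H : Subgroup (V ≃ₗ[ZMod p] V)} {d : ℕ} (hbot : H ≠ ⊥) [Group.IsSolvable H]
    (hirr : (natRep H).IsIrreducible) (hd : Group.rank H < d)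
    (e : (G ⧸ frattini G) ≃* PowSemidirect H (Module.finrank (endH H) V * (d - 2) + 1)) :
    psi G = Group.rank G := by
  rw [isIrreducible_natRep_iff] at hirr
  refine le_antisymm ?_ rank_le_psi
  have hnt : Nontrivial H := (Subgroup.nontrivial_iff_ne_bot _).2 hbot
  let _ := divisionRingEndH hirr
  have := hirr.nontrivial
  have hd2 : 2 ≤ d := by
    have := Group.rank_pos H
    omega
  have hpV : ∀ v : V, p • v = 0 := fun v => by
    rw [← Nat.cast_smul_eq_nsmul (ZMod p), CharP.cast_eq_zero, zero_smul]
  have hX := isPowerExtension_powSemidirect hirr (Module.finrank (endH H) V * (d - 2) + 1)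
  have hn : Module.finrank (endH H) V * (d - 2) + 1 + Module.finrank (endH H) V =
      (d - 1) * Module.finrank (endH H) V + 1 := by
    obtain ⟨k, rfl⟩ : ∃ k, d = k + 2 := ⟨d - 2, by omega⟩
    rw [show k + 2 - 2 = k by omega, show k + 2 - 1 = k + 1 by omega]
    ring
  let f := e.toMonoidHom.comp (QuotientGroup.mk' (frattini G))
  have hf : Function.Surjective f := e.surjective.comp (QuotientGroup.mk'_surjective _)
  have hk : f.ker ≤ frattini G := by
    intro x hx
    have h1 : e (QuotientGroup.mk' (frattini G) x) = 1 := hx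
    rw [map_eq_one_iff e e.injective] at h1
    exact (QuotientGroup.eq_one_iff x).1 h1
  refine le_trans (psi_le_of_surjective f hf hk (r := d) (by omega) fun x y hxy => ?_) ?_
  · exact equivM_of_equivMr (fun M hM x hx => hX.exists_tuple_mem hirr (isFullEnd_endH H)
      Fact.out hpV (by omega) (by omega) hn.le hM hx) hxy
  · by_contra! hlt
    have h1 : Group.rank G ≤ d - 1 := by omega
    obtain ⟨z, hz⟩ := rank_le_iff_exists_tuple.1 h1
    have h2 := (closure_image_eq_top_iff f hf hk _).2 hz
    rw [← Set.range_comp] at h2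
    have := hX.add_finrank_le hirr h2
    omega

end GenEquiv

theorem mainTheorem2 (G : Type*) [Group G] [Finite G] [Nontrivial G] [Group.IsSolvable G] :
    GenEquiv.psi G = Group.rank G ↔
      (∃ p : ℕ, p.Prime ∧ IsPGroup p G) ∨
      ∃ (p : ℕ) (_ : Fact p.Prime) (V : Type) (_ : AddCommGroup V) (_ : Module (ZMod p) V)
        (_ : Finite V) (H : Subgroup (V ≃ₗ[ZMod p] V)) (d : ℕ),
        H ≠ ⊥ ∧ Group.IsSolvable H ∧ (GenEquiv.natRep H).IsIrreducible ∧ Group.rank H < d ∧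
          Nonempty ((G ⧸ frattini G) ≃* GenEquiv.PowSemidirect H
            (Module.finrank (GenEquiv.endH H) V * (d - 2) + 1)) := by
  constructor
  · intro h
    have hf := QuotientGroup.mk'_surjective (frattini G)
    have hk : (QuotientGroup.mk' (frattini G)).ker ≤ frattini G := (QuotientGroup.ker_mk' _).le
    have hQ : Nontrivial (G ⧸ frattini G) :=
      QuotientGroup.nontrivial_iff.2 GenEquiv.frattini_ne_top
    have hpos := Group.rank_pos G
    -- Generators of the Frattini quotient lift to generators of `G`, so passing to it does not
    -- lower the rank.
    have hrank : Group.rank G - 1 < Group.rank (G ⧸ frattini G) := by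
      by_contra! hle
      obtain ⟨z, hz⟩ := GenEquiv.rank_le_iff_exists_tuple.1 hle
      choose w hw using fun i => hf (z i)
      rw [show z = QuotientGroup.mk' (frattini G) ∘ w from (funext hw).symm, Set.range_comp,
        GenEquiv.closure_image_eq_top_iff _ hf hk] at hz
      have := GenEquiv.rank_le_iff_exists_tuple.2 ⟨w, hz⟩
      omega
    rcases GenEquiv.isPGroup_or_nonempty_mulEquiv hrank (fun x hx => by
      obtain ⟨g, rfl⟩ := hf x
      obtain ⟨z, hz⟩ := GenEquiv.exists_closure_insert_eq_top h
        (fun hg => hx ((QuotientGroup.eq_one_iff g).2 hg))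
      refine ⟨QuotientGroup.mk' (frattini G) ∘ z, ?_⟩
      rwa [Set.range_comp, ← Set.image_insert_eq, GenEquiv.closure_image_eq_top_iff _ hf hk])
      with ⟨p, hp, hpQ⟩ | ⟨p, hp, N, H, h1, h2, h3, h4, h5⟩
    · have := Fact.mk hp
      exact Or.inl ⟨p, hp, GenEquiv.isPGroup_of_quotient_frattini hpQ⟩
    · exact Or.inr ⟨p, hp, Fin N → ZMod p, inferInstance, inferInstance, inferInstance, H,
        Group.rank G - 1 + 1, h1, h2, h3, h4, h5⟩
  · rintro (⟨p, hp, hG⟩ | ⟨p, hp, V, _, _, _, H, d, h1, h2, h3, h4, ⟨e⟩⟩)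
    · have := Fact.mk hp
      exact GenEquiv.psi_eq_rank_of_isPGroup hG
    · exact GenEquiv.psi_eq_rank_of_mulEquiv h1 h3 h4 e
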